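/- For a finite graph $G=(V,E)$ and $\lambda\in\mathbb{C}$ let $Z_{G,\lambda}=\sum_{S}\lambda^{|S|}$, the sum over all independent sets $S\subseteq V$ of $G$, be the (univariate) independence polynomial. For $1\le a\le b\le c$ the subdivided claw $S_{a,b,c}$ is the tree formed by a central vertex and three paths attached to it, whose leaves are at distances $a$, $b$, $c$ from the centre. A graph is $H$-free if it has no induced subgraph isomorphic to $H$. For integers $k,d\ge 0$ let $T_{k,d}$ be the tree obtained from the complete binary tree of height $d$ (so $d=0$ gives a single vertex) by subdividing each edge $2k$ times. Let $H$ be a finite connected graph that is neither a path nor a subdivided claw. Call an integer $k\ge 0$ admissible for $H$ if $H$ contains a cycle, or $H$ has a vertex of degree at least $4$, or $H$ has two distinct vertices of degree $3$ at distance less than $k$. Then an admissible $k$ exists, and for every admissible $k$: 1. for every $d\ge 0$ the tree $T_{k,d}$ is $H$-free and all its vertices have degree at most $3$, and its maximum degree is exactly $3$ when $d\ge 2$; 2. the set of zeros $$\{\lambda\in\mathbb{C} : Z_{T_{k,d},\lambda}=0 \text{ for some } d\ge 0\}$$ has an accumulation point on the positive real axis $(0,\infty)$. -/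

import Mathlib

open Filter Topology

namespace HFreeZeros

/-- The multivariate independence polynomial (hard-core partition function)
`Z_{G, lam} = ∑_{S independent in G} ∏_{v ∈ S} lam v` of a finite graph. -/
noncomputable def indepZ {V : Type*} [Fintype V] (G : SimpleGraph V) (lam : V → ℂ) : ℂ :=
  open Classical in
  ∑ S ∈ (Finset.univ : Finset (Finset V)) with G.IsIndepSet (S : Set V), ∏ v ∈ S, lam v

/-- `G` is `H`-free: it has no induced subgraph isomorphic to `H`. -/
def IsFree {V W : Type*} (H : SimpleGraph V) (G : SimpleGraph W) : Prop :=
  ¬ H.IsIndContained G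

/-- `H` is a path (with any number of vertices). -/
def IsPathGraph {V : Type*} (H : SimpleGraph V) : Prop :=
  ∃ n : ℕ, Nonempty (H ≃g SimpleGraph.pathGraph n)

/-- The graph `S_{a,b,c}`: a centre `none` and three legs with `a`, `b` and `c` further vertices;
the vertex `some ⟨t, p⟩` lies on leg `t` at distance `p + 1` from the centre. -/
def subdividedClaw (a b c : ℕ) : SimpleGraph (Option (Σ t : Fin 3, Fin (![a, b, c] t))) :=
  SimpleGraph.fromRel fun x y =>
    (x = none ∧ ∃ t p, y = some ⟨t, p⟩ ∧ (p : ℕ) = 0) ∨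
    (∃ t p q, x = some ⟨t, p⟩ ∧ y = some ⟨t, q⟩ ∧ (q : ℕ) = p + 1)

/-- `H` is a subdivided claw. -/
def IsSubdividedClaw {V : Type*} (H : SimpleGraph V) : Prop :=
  ∃ a b c : ℕ, 1 ≤ a ∧ a ≤ b ∧ b ≤ c ∧ Nonempty (H ≃g subdividedClaw a b c)

/-- Vertices of the complete binary tree of height `d` with every edge subdivided `2 * k` times.
The vertices of the complete binary tree are the binary words `w` of length at most `d`; the root
is the empty word and the children of `w` are `w ++ [false]` and `w ++ [true]`.
The pair `(w, 0)` is the branch vertex `w`; for `w` not the root and `1 ≤ i ≤ 2 * k`, the pair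
`(w, i)` is the vertex at distance `i` from `w` on the subdivided edge from `w` to its parent. -/
def TreeVertex (k d : ℕ) : Type :=
  {x : List Bool × Fin (2 * k + 1) // x.1.length ≤ d ∧ (x.1 = [] → x.2 = 0)}

instance treeVertexFinite (k d : ℕ) : Finite (TreeVertex k d) := by
  have h : Finite {l : List Bool | l.length ≤ d} := (List.finite_length_le Bool d).to_subtype
  refine Finite.of_injective
    (fun x : TreeVertex k d =>
      ((⟨x.1.1, x.2.1⟩, x.1.2) : {l : List Bool | l.length ≤ d} × Fin (2 * k + 1))) ?_
  intro x y hxy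
  simp only [Prod.mk.injEq, Subtype.mk.injEq] at hxy
  exact Subtype.ext (Prod.ext hxy.1 hxy.2)

noncomputable instance treeVertexFintype (k d : ℕ) : Fintype (TreeVertex k d) :=
  Fintype.ofFinite _

/-- `y` is the next vertex after `x` on the way to the root. -/
def IsParent {k d : ℕ} (x y : TreeVertex k d) : Prop :=
  (x.1.1 = y.1.1 ∧ (y.1.2 : ℕ) = x.1.2 + 1) ∨
  ((x.1.2 : ℕ) = 2 * k ∧ (y.1.2 : ℕ) = 0 ∧ ∃ b : Bool, x.1.1 = y.1.1 ++ [b])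

/-- The tree `T_d`: the complete binary tree of height `d`, every edge subdivided `2 * k` times. -/
def tree (k d : ℕ) : SimpleGraph (TreeVertex k d) :=
  SimpleGraph.fromRel IsParent

noncomputable instance treeDecidable (k d : ℕ) : DecidableRel (tree k d).Adj :=
  Classical.decRel _

/-- The admissible subdivision parameters for `H`: any `k` if `H` contains a cycle or a vertex of
degree at least four; otherwise any `k` larger than the distance between some two vertices of
degree three. -/
def Admissible {V : Type*} [Fintype V] (H : SimpleGraph V) [DecidableRel H.Adj] (k : ℕ) : Prop :=
  ¬ H.IsAcyclic ∨ (∃ v, 4 ≤ H.degree v) ∨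
    (∃ u v, u ≠ v ∧ H.degree u = 3 ∧ H.degree v = 3 ∧ H.dist u v < k)

end HFreeZeros

/-! Zeros. The pair (Z(T_d - root), Z(T_d)) obeys a recursion in d (`rootPair`, `indepZ_tree`), and
at a fugacity x > 0 the ratio R_d of its entries is iterated by a self-map of [0, 1]. For x ≤ 1/4
this map contracts, so R_d - R_{d+1} tends to 0 (`rootRatio_tendsto_of_le`); for large x, R_d
alternates between values at most 1/4 and at least 1/2 (`rootRatio_oscillates`). If zeros
accumulated nowhere on the positive axis, every point of it would have a zero-free complex
neighbourhood, on which all R_d are holomorphic. With x = s ^ 2, Z(T_{d+1}) is a product of two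
linear forms in the pair of T_d, so R_d also omits two values moving holomorphically with s.
Schottky's theorem then bounds the R_d locally (`occRatio_bounded`), and a Vitali argument
(`tendsto_zero_of_bounded`) carries R_d - R_{d+1} → 0 past the point, hence along the whole axis,
contradicting the oscillation.

Freeness. T_{k,d} is acyclic, has degrees at most 3, and its degree-3 vertices are at least 2k + 1
apart, so each form of admissibility forbids an induced copy of H (`isFree_tree`). A connected graph
with no admissible k is a tree of maximum degree at most 3 with at most one vertex of degree 3, that
is, a path or a subdivided claw (`exists_admissible`). -/

namespace HFreeZeros

open Metric Set

/-! ### Complex analysis: Bloch, Schottky and a Vitali theorem. -/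

/-- A nowhere vanishing holomorphic function on a disc has a holomorphic logarithm with a
prescribed value at the centre. -/
lemma exists_log_on_ball {f : ℂ → ℂ} {c w : ℂ} {r : ℝ} (hr : 0 < r)
    (hf : DifferentiableOn ℂ f (ball c r)) (h0 : ∀ z ∈ ball c r, f z ≠ 0)
    (hw : Complex.exp w = f c) :
    ∃ F : ℂ → ℂ, DifferentiableOn ℂ F (ball c r) ∧ F c = w ∧
      ∀ z ∈ ball c r, Complex.exp (F z) = f z := by
  have hd : DifferentiableOn ℂ (fun z => deriv f z / f z) (ball c r) :=
    (hf.deriv isOpen_ball).div hf h0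
  obtain ⟨F, hFc, hF⟩ := hd.isExactOn_ball.with_val_at c w
  refine ⟨F, fun z hz => (hF z hz).differentiableAt.differentiableWithinAt, hFc, ?_⟩
  have hder : ∀ z ∈ ball c r,
      HasDerivAt (fun z => f z * Complex.exp (-F z)) 0 z := by
    intro z hz
    have h1 := (hf.differentiableAt (isOpen_ball.mem_nhds hz)).hasDerivAt
    have h2 := h1.mul (hF z hz).neg.cexp
    refine h2.congr_deriv ?_
    have := h0 z hz
    field_simp
    ring
  have hc : c ∈ ball c r := mem_ball_self hr
  intro z hz
  have key : f z * Complex.exp (-F z) = f c * Complex.exp (-F c) :=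
    isOpen_ball.is_const_of_deriv_eq_zero (convex_ball c r).isPreconnected
      (fun z hz => (hder z hz).differentiableAt.differentiableWithinAt)
      (fun z hz => (hder z hz).deriv) hz hc
  rw [hFc, ← hw, ← Complex.exp_add, add_neg_cancel, Complex.exp_zero] at key
  have := congrArg (· * Complex.exp (F z)) key
  simp only [mul_assoc, ← Complex.exp_add, neg_add_cancel, Complex.exp_zero, mul_one,
    one_mul] at this
  exact this.symm

/-- A holomorphic function whose derivative is controlled by its value at the centre covers a disc
of definite size. -/
lemma ball_subset_image_of_norm_deriv_le {f : ℂ → ℂ} {p : ℂ} {t : ℝ} (ht : 0 < t)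
    (hf : DifferentiableOn ℂ f (ball p t)) (h0 : deriv f p ≠ 0)
    (hb : ∀ z ∈ ball p t, ‖deriv f z‖ ≤ 2 * ‖deriv f p‖) :
    ball (f p) (t * ‖deriv f p‖ / 24) ⊆ f '' ball p t := by
  set m := ‖deriv f p‖ with hm
  have hmpos : 0 < m := norm_pos_iff.mpr h0
  -- With radius t / 6 the Schwarz lemma for f' - f'(p), of size at most 3m, gives the bound m / 2.
  -- So f differs from its linear part by at most tm / 12 on the sphere, where the linear part has
  -- size tm / 6.
  have hsub : closedBall p (t / 6) ⊆ ball p t := closedBall_subset_ball (by linarith)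
  have hd' : DifferentiableOn ℂ (deriv f) (ball p t) := hf.deriv isOpen_ball
  have hmaps : MapsTo (deriv f) (ball p t) (closedBall (deriv f p) (3 * m)) := by
    intro z hz
    rw [mem_closedBall, dist_eq_norm]
    calc ‖deriv f z - deriv f p‖ ≤ ‖deriv f z‖ + ‖deriv f p‖ := norm_sub_le _ _
      _ ≤ 3 * m := by linarith [hb z hz]
  have hder : ∀ z ∈ closedBall p (t / 6), HasDerivWithinAt
      (fun z => f z - deriv f p * z) (deriv f z - deriv f p) (closedBall p (t / 6)) z := by
    intro z hz
    have h1 := (hf.differentiableAt (isOpen_ball.mem_nhds (hsub hz))).hasDerivAt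
    simpa using (h1.fun_sub ((hasDerivAt_id z).const_mul (deriv f p))).hasDerivWithinAt
  have hbound : ∀ z ∈ closedBall p (t / 6), ‖deriv f z - deriv f p‖ ≤ m / 2 := by
    intro z hz
    have h1 := Complex.dist_le_div_mul_dist_of_mapsTo_ball hd' hmaps (hsub hz)
    rw [dist_eq_norm] at h1
    refine h1.trans ?_
    calc 3 * m / t * dist z p ≤ 3 * m / t * (t / 6) := by
          gcongr; exact hz
      _ = m / 2 := by field_simp; norm_num
  have hp : p ∈ closedBall p (t / 6) := mem_closedBall_self (by positivity)
  have hlow : ∀ z ∈ sphere p (t / 6), t * m / 12 ≤ ‖f z - f p‖ := by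
    intro z hz
    have h1 := (convex_closedBall p (t / 6)).norm_image_sub_le_of_norm_hasDerivWithin_le
      hder hbound hp (sphere_subset_closedBall hz)
    have hz' : ‖z - p‖ = t / 6 := by rwa [mem_sphere, dist_eq_norm] at hz
    rw [hz'] at h1
    have h2 : ‖deriv f p * (z - p)‖ = m * (t / 6) := by rw [norm_mul, hz']
    have h3 : deriv f p * (z - p) = (f z - f p) -
        (f z - deriv f p * z - (f p - deriv f p * p)) := by ring
    have h4 := norm_sub_le (f z - f p) (f z - deriv f p * z - (f p - deriv f p * p))
    rw [← h3, h2] at h4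
    linarith
  have hfreq : ∃ᶠ z in 𝓝 p, f z ≠ f p := by
    have h1 := (hf.differentiableAt (ball_mem_nhds p ht)).hasDerivAt.eventually_ne
      (c := f p) h0
    exact h1.frequently.filter_mono nhdsWithin_le_nhds
  have hdc : DiffContOnCl ℂ f (ball p (t / 6)) := by
    refine ((hf.mono hsub).diffContOnCl_ball (U := closedBall p (t / 6))) ?_
    exact subset_rfl
  have := hdc.ball_subset_image_closedBall (by positivity) hlow hfreq
  have he : t * m / 12 / 2 = t * m / 24 := by ring
  rw [he] at this
  exact this.trans (image_mono hsub)

/-- Bloch's theorem. -/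
lemma bloch {f : ℂ → ℂ} {U : Set ℂ} {a : ℂ} {ρ : ℝ} (hU : IsOpen U) (hρ : 0 < ρ)
    (hf : DifferentiableOn ℂ f U) (hsub : closedBall a ρ ⊆ U) (h0 : deriv f a ≠ 0) :
    ∃ w, ball w (ρ * ‖deriv f a‖ / 48) ⊆ f '' U := by
  have hd' : DifferentiableOn ℂ (deriv f) U := hf.deriv hU
  -- Maximising |f'(z)| times the distance to the boundary gives a point p around which |f'| at most
  -- doubles, on the disc of half that distance.
  have hcont : ContinuousOn (fun z => ‖deriv f z‖ * (ρ - dist z a)) (closedBall a ρ) :=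
    (hd'.continuousOn.mono hsub).norm.mul (by fun_prop)
  have ha : a ∈ closedBall a ρ := mem_closedBall_self hρ.le
  obtain ⟨p, hp, hmax⟩ := (isCompact_closedBall a ρ).exists_isMaxOn ⟨a, ha⟩ hcont
  have hmax' : ∀ z ∈ closedBall a ρ,
      ‖deriv f z‖ * (ρ - dist z a) ≤ ‖deriv f p‖ * (ρ - dist p a) := fun z hz => hmax hz
  have hN := hmax' a ha
  rw [dist_self, sub_zero] at hN
  have hNpos : 0 < ‖deriv f p‖ * (ρ - dist p a) :=
    lt_of_lt_of_le (mul_pos (norm_pos_iff.mpr h0) hρ) hN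
  have hpos : 0 < ρ - dist p a := pos_of_mul_pos_right hNpos (norm_nonneg _)
  have hp0 : 0 < ‖deriv f p‖ := pos_of_mul_pos_left hNpos hpos.le
  set t := (ρ - dist p a) / 2 with ht
  have htpos : 0 < t := by positivity
  have hball : ∀ z ∈ ball p t, t ≤ ρ - dist z a := by
    intro z hz
    have := dist_triangle z p a
    have hz' := mem_ball.mp hz
    linarith
  have hbs : ball p t ⊆ U := fun z hz => hsub (by
    rw [mem_closedBall]; linarith [hball z hz])
  have h := ball_subset_image_of_norm_deriv_le htpos (hf.mono hbs) (norm_pos_iff.mp hp0) (by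
    intro z hz
    have h1 := hmax' z (by rw [mem_closedBall]; linarith [hball z hz])
    have h2 : ‖deriv f z‖ * t ≤ ‖deriv f z‖ * (ρ - dist z a) := by
      gcongr; exact hball z hz
    have h3 : ‖deriv f z‖ * t ≤ (2 * ‖deriv f p‖) * t := by
      calc _ ≤ ‖deriv f p‖ * (ρ - dist p a) := h2.trans h1
        _ = _ := by rw [ht]; ring
    exact le_of_mul_le_mul_right h3 htpos)
  refine ⟨f p, (ball_subset_ball ?_).trans (h.trans (image_mono hbs))⟩
  have : t * ‖deriv f p‖ / 24 = ‖deriv f p‖ * (ρ - dist p a) / 48 := by rw [ht]; ring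
  rw [this]
  linarith

/-- Every disc of radius `5` contains a point where `cosh` takes an integer value. -/
lemma exists_cosh_eq_int (w : ℂ) : ∃ z ∈ ball w 5, ∃ n : ℤ, Complex.cosh z = n := by
  -- On the lines Im z = mπ the function is ± cosh (Re z), which passes an integer on every real
  -- interval of length 2 lying on one side of 0. Real and imaginary offsets are each at most 2.
  have hgrow : ∀ x : ℝ, 0 ≤ x → Real.cosh x + 1 ≤ Real.cosh (x + 2) := by
    intro x hx
    rw [Real.cosh_add]
    have h1 : 2 ≤ Real.cosh 2 := by
      rw [Real.cosh_eq]
      have := Real.add_one_le_exp (1 : ℝ)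
      have h2 : Real.exp 2 = Real.exp 1 * Real.exp 1 := by rw [← Real.exp_add]; norm_num
      nlinarith [Real.exp_pos (-2)]
    have h3 := Real.one_le_cosh x
    have h4 : 0 ≤ Real.sinh x := Real.sinh_nonneg_iff.mpr hx
    have h5 : 0 ≤ Real.sinh 2 := Real.sinh_nonneg_iff.mpr (by norm_num)
    nlinarith [mul_nonneg h4 h5]
  have hnn : ∀ x : ℝ, 0 ≤ x → ∃ y ∈ Icc x (x + 2), ∃ n : ℤ, Real.cosh y = n := by
    intro x hx
    have h := intermediate_value_Icc (by linarith : x ≤ x + 2)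
      (Real.continuous_cosh.continuousOn (s := Icc x (x + 2)))
    have hm : (⌈Real.cosh x⌉ : ℝ) ∈ Icc (Real.cosh x) (Real.cosh (x + 2)) :=
      ⟨Int.le_ceil _, (Int.ceil_lt_add_one _).le.trans (hgrow x hx)⟩
    obtain ⟨y, hy, he⟩ := h hm
    exact ⟨y, hy, _, he⟩
  obtain ⟨y, hy, n, hn⟩ : ∃ y : ℝ, |y - w.re| ≤ 2 ∧ ∃ n : ℤ, Real.cosh y = n := by
    rcases le_total 0 w.re with h | h
    · obtain ⟨y, hy, hn⟩ := hnn _ h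
      exact ⟨y, by rw [abs_le]; constructor <;> linarith [hy.1, hy.2], hn⟩
    · obtain ⟨y, hy, n, hn⟩ := hnn (-w.re) (by linarith)
      exact ⟨-y, by rw [abs_le]; constructor <;> linarith [hy.1, hy.2], n, by
        rw [Real.cosh_neg, hn]⟩
  set m : ℤ := round (w.im / Real.pi) with hm
  have him : |m * Real.pi - w.im| ≤ 2 := by
    have h1 := abs_sub_round (w.im / Real.pi)
    rw [← hm] at h1
    have h2 : (m : ℝ) * Real.pi - w.im = -((w.im / Real.pi - m) * Real.pi) := by
      field_simp; ring
    rw [h2, abs_neg, abs_mul, abs_of_pos Real.pi_pos]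
    nlinarith [Real.pi_le_four, Real.pi_pos]
  refine ⟨(y : ℂ) + (m * Real.pi : ℝ) * Complex.I, ?_, (-1) ^ m.natAbs * n, ?_⟩
  · rw [mem_ball, dist_eq_norm]
    refine (Complex.norm_le_abs_re_add_abs_im _).trans_lt ?_
    simp only [Complex.sub_re, Complex.add_re, Complex.ofReal_re, Complex.mul_re, Complex.I_re,
      mul_zero, Complex.ofReal_im, Complex.I_im, mul_one, sub_self, add_zero, Complex.sub_im,
      Complex.add_im, Complex.mul_im, zero_add]
    linarith
  · rw [Complex.cosh_add, Complex.cosh_mul_I, Complex.sinh_mul_I]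
    have hs : Complex.sin ((m * Real.pi : ℝ) : ℂ) = 0 := by
      rw [← Complex.ofReal_sin, Real.sin_int_mul_pi, Complex.ofReal_zero]
    have hc : Complex.cos ((m * Real.pi : ℝ) : ℂ) = (-1) ^ m.natAbs := by
      rw [← Complex.ofReal_cos, Real.cos_int_mul_pi]
      rcases Int.even_or_odd m with h | h
      · rw [h.neg_one_zpow, (Int.natAbs_even.mpr h).neg_one_pow]; simp
      · rw [h.neg_one_zpow, (Int.natAbs_odd.mpr h).neg_one_pow]; simp
    rw [hs, hc, ← Complex.ofReal_cosh, hn]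
    push_cast
    ring

/-- Schottky's theorem: a holomorphic function on a disc omitting `0` and `1` is bounded on the
concentric disc of half the radius in terms of its value at the centre. -/
theorem schottky (K : ℝ) : ∃ M : ℝ, ∀ (f : ℂ → ℂ) (c : ℂ) (r : ℝ), 0 < r →
    DifferentiableOn ℂ f (ball c r) → (∀ z ∈ ball c r, f z ≠ 0 ∧ f z ≠ 1) →
    |Real.log ‖f c‖| ≤ K → ∀ z ∈ ball c (r / 2), ‖f z‖ ≤ M := by
  -- Write f = exp(2πiF) and F = cosh G. Then F omits the integers and G omits their preimages under
  -- cosh, which meet every disc of radius 5, so Bloch's theorem bounds G'. B bounds |F(c)|.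
  set B : ℝ := K + Real.pi with hB
  refine ⟨Real.exp (2 * Real.pi * Real.exp (480 + (2 * B + Real.pi))), ?_⟩
  intro f c r hr hf h01 hK
  have hc : c ∈ ball c r := mem_ball_self hr
  have hpi := Real.pi_pos
  have h2pi : (2 * Real.pi * Complex.I : ℂ) ≠ 0 := Complex.two_pi_I_ne_zero
  obtain ⟨L, hLd, hLc, hL⟩ := exists_log_on_ball hr hf (fun z hz => (h01 z hz).1)
    (Complex.exp_log (h01 c hc).1)
  set F : ℂ → ℂ := fun z => L z / (2 * Real.pi * Complex.I) with hF
  have hFd : DifferentiableOn ℂ F (ball c r) := hLd.div_const _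
  have hFf : ∀ z ∈ ball c r, f z = Complex.exp (2 * Real.pi * Complex.I * F z) := by
    intro z hz
    rw [hF, ← hL z hz]
    congr 1
    field_simp
  have hFint : ∀ z ∈ ball c r, ∀ n : ℤ, F z ≠ n := by
    intro z hz n hn
    apply (h01 z hz).2
    rw [hFf z hz, hn, mul_comm]
    exact Complex.exp_int_mul_two_pi_mul_I n
  have hFc : ‖F c‖ ≤ B := by
    have h1 : ‖F c‖ = ‖L c‖ / (2 * Real.pi) := by
      simp only [hF, norm_div, norm_mul, Complex.norm_I, mul_one, Complex.norm_ofNat,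
        Complex.norm_real, Real.norm_eq_abs, abs_of_pos hpi]
    have h2 : ‖L c‖ ≤ K + Real.pi := by
      rw [hLc]
      refine (Complex.norm_le_abs_re_add_abs_im _).trans ?_
      rw [Complex.log_re, Complex.log_im]
      exact add_le_add hK (Complex.abs_arg_le_pi _)
    rw [h1]
    exact (div_le_self (norm_nonneg _) (by linarith [Real.pi_gt_three])).trans h2
  have hsq : ∀ z ∈ ball c r, F z ^ 2 - 1 ≠ 0 := by
    intro z hz h
    have h1 : (F z - 1) * (F z + 1) = 0 := by linear_combination h
    rcases mul_eq_zero.mp h1 with h2 | h2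
    · exact hFint z hz 1 (by push_cast; linear_combination h2)
    · exact hFint z hz (-1) (by push_cast; linear_combination h2)
  obtain ⟨T, hTd, -, hT⟩ := exists_log_on_ball hr ((hFd.pow 2).sub_const 1) hsq
    (Complex.exp_log (hsq c hc))
  set S : ℂ → ℂ := fun z => Complex.exp (T z / 2) with hS
  have hSd : DifferentiableOn ℂ S (ball c r) := (hTd.div_const 2).cexp
  have hS2 : ∀ z ∈ ball c r, S z ^ 2 = F z ^ 2 - 1 := by
    intro z hz
    rw [← show _ = F z ^ 2 - 1 from hT z hz, hS, ← Complex.exp_nat_mul]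
    congr 1
    push_cast
    ring
  have hprod : ∀ z ∈ ball c r, (F z + S z) * (F z - S z) = 1 := by
    intro z hz
    linear_combination -hS2 z hz
  have hne : ∀ z ∈ ball c r, F z + S z ≠ 0 := fun z hz h => by
    have := hprod z hz
    rw [h, zero_mul] at this
    exact zero_ne_one this
  obtain ⟨G, hGd, hGc, hG⟩ := exists_log_on_ball hr (hFd.add hSd) hne
    (Complex.exp_log (hne c hc))
  have hGneg : ∀ z ∈ ball c r, Complex.exp (-G z) = F z - S z := by
    intro z hz
    rw [Complex.exp_neg, hG z hz]
    exact inv_eq_of_mul_eq_one_right (hprod z hz)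
  have hcosh : ∀ z ∈ ball c r, Complex.cosh (G z) = F z := by
    intro z hz
    rw [Complex.cosh, hG z hz, hGneg z hz]
    simp only [Pi.add_apply]
    ring
  have hSc : ‖S c‖ ≤ ‖F c‖ + 1 := by
    have h1 : ‖S c‖ ^ 2 ≤ ‖F c‖ ^ 2 + 1 := by
      rw [← norm_pow, hS2 c hc, ← norm_pow]
      exact (norm_sub_le _ _).trans (by simp)
    nlinarith [norm_nonneg (S c), norm_nonneg (F c)]
  have hGre : |(G c).re| ≤ 2 * B := by
    have h1 : Real.exp (G c).re ≤ 1 + 2 * B := by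
      rw [← Complex.norm_exp, hG c hc]
      exact (norm_add_le _ _).trans (by linarith)
    have h2 : Real.exp (-(G c).re) ≤ 1 + 2 * B := by
      rw [← Complex.neg_re, ← Complex.norm_exp, hGneg c hc]
      exact (norm_sub_le _ _).trans (by linarith)
    rw [abs_le]
    constructor <;> linarith [Real.add_one_le_exp (G c).re, Real.add_one_le_exp (-(G c).re)]
  have hGnorm : ‖G c‖ ≤ 2 * B + Real.pi := by
    refine (Complex.norm_le_abs_re_add_abs_im _).trans (add_le_add hGre ?_)
    rw [hGc, Complex.log_im]
    exact Complex.abs_arg_le_pi _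
  have hsub : ∀ z ∈ ball c (r / 2), closedBall z (r / 4) ⊆ ball c r := by
    intro z hz y hy
    have := dist_triangle y z c
    rw [mem_ball] at *
    rw [mem_closedBall] at hy
    linarith
  -- 960 = 5 · 4 · 48: a larger derivative gives a Bloch disc of radius above 5 in the image of G.
  have hGder : ∀ z ∈ ball c (r / 2), ‖deriv G z‖ ≤ 960 / r := by
    intro z hz
    by_cases h0 : deriv G z = 0
    · rw [h0, norm_zero]; positivity
    by_contra hlt
    rw [not_le, div_lt_iff₀ hr] at hlt
    obtain ⟨w, hw⟩ := bloch isOpen_ball (by positivity : 0 < r / 4) hGd (hsub z hz) h0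
    obtain ⟨x, hx, n, hn⟩ := exists_cosh_eq_int w
    obtain ⟨y, hy, hyx⟩ := hw (ball_subset_ball (by linarith) hx)
    exact hFint y hy n (by rw [← hcosh y hy, hyx, hn])
  have hhalf : ball c (r / 2) ⊆ ball c r := ball_subset_ball (by linarith)
  have hGbd : ∀ z ∈ ball c (r / 2), ‖G z‖ ≤ 480 + (2 * B + Real.pi) := by
    intro z hz
    have h1 := (convex_ball c (r / 2)).norm_image_sub_le_of_norm_deriv_le
      (fun y hy => hGd.differentiableAt (isOpen_ball.mem_nhds (hhalf hy))) hGder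
      (mem_ball_self (by positivity)) hz
    have h2 : ‖z - c‖ ≤ r / 2 := by rw [← dist_eq_norm]; exact (mem_ball.mp hz).le
    have h3 : 960 / r * ‖z - c‖ ≤ 480 := by
      calc 960 / r * ‖z - c‖ ≤ 960 / r * (r / 2) := by gcongr
        _ = 480 := by field_simp; norm_num
    have h4 : ‖G z‖ ≤ ‖G z - G c‖ + ‖G c‖ := by
      simpa using norm_add_le (G z - G c) (G c)
    linarith
  intro z hz
  have hz' := hhalf hz
  rw [hFf z hz', Complex.norm_exp]
  apply Real.exp_le_exp.mpr
  refine (Complex.re_le_norm _).trans ?_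
  rw [norm_mul, norm_mul, norm_mul, Complex.norm_I, mul_one, Complex.norm_ofNat,
    Complex.norm_real, Real.norm_eq_abs, abs_of_pos hpi]
  gcongr
  rw [← hcosh z hz', Complex.cosh, norm_div, Complex.norm_ofNat, div_le_iff₀ (by norm_num)]
  have h1 : ∀ w : ℂ, ‖w‖ ≤ 480 + (2 * B + Real.pi) →
      ‖Complex.exp w‖ ≤ Real.exp (480 + (2 * B + Real.pi)) := by
    intro w hw
    rw [Complex.norm_exp]
    exact Real.exp_le_exp.mpr ((Complex.re_le_norm w).trans hw)
  have h2 := h1 _ (hGbd z hz)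
  have h3 := h1 (-G z) (by rw [norm_neg]; exact hGbd z hz)
  linarith [norm_add_le (Complex.exp (G z)) (Complex.exp (-G z))]

/-- A uniformly bounded sequence of holomorphic functions on a disc that tends to `0` on a set
accumulating at the centre tends to `0` on the concentric disc of half the radius. -/
theorem tendsto_zero_of_bounded {A : Set ℂ} {c : ℂ} {r : ℝ} (hr : 0 < r)
    (hA : ∀ ε > 0, ∃ a ∈ A, a ≠ c ∧ dist a c < ε)
    {M : ℝ} {g : ℕ → ℂ → ℂ} (hg : ∀ n, DifferentiableOn ℂ (g n) (ball c r))
    (hM : ∀ n, ∀ z ∈ ball c r, ‖g n z‖ ≤ M)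
    (hlim : ∀ a ∈ A, a ∈ ball c r → Tendsto (fun n => g n a) atTop (𝓝 0)) {z : ℂ}
    (hz : z ∈ ball c (r / 2)) : Tendsto (fun n => g n z) atTop (𝓝 0) := by
  have hz' : z ∈ ball c r := ball_subset_ball (by linarith) hz
  have hcr : c ∈ ball c r := mem_ball_self hr
  -- Dividing out the asymptotic zero at c gives difference quotients bounded by 2M / r that again
  -- tend to 0 on A away from c. Each such division gains a factor 2 dist(z, c) / r, which is below
  -- 1 on the half disc.
  have main : ∀ k : ℕ, ∀ (M : ℝ) (g : ℕ → ℂ → ℂ), (∀ n, DifferentiableOn ℂ (g n) (ball c r)) →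
      (∀ n, ∀ z ∈ ball c r, ‖g n z‖ ≤ M) →
      (∀ a ∈ A, a ∈ ball c r → a ≠ c → Tendsto (fun n => g n a) atTop (𝓝 0)) →
      ∀ ε > 0, ∀ᶠ n in atTop, ‖g n z‖ ≤ M * (2 * dist z c / r) ^ k + ε := by
    intro k
    induction k with
    | zero =>
      intro M g hg hM hlim ε hε
      filter_upwards with n
      have := hM n z hz'
      rw [pow_zero, mul_one]
      linarith
    | succ k ih =>
      intro M g hg hM hlim ε hε
      have hM0 : 0 ≤ M := (norm_nonneg _).trans (hM 0 c hcr)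
      have hmaps : ∀ n, MapsTo (g n) (ball c r) (closedBall (g n c) (2 * M)) := by
        intro n y hy
        rw [mem_closedBall, dist_eq_norm]
        exact (norm_sub_le _ _).trans (by linarith [hM n y hy, hM n c hcr])
      -- The Schwarz lemma compares g_n(c) with g_n(a), uniformly in n, for a in A close to c.
      have hcen : Tendsto (fun n => g n c) atTop (𝓝 0) := by
        rw [Metric.tendsto_atTop']
        intro δ hδ
        obtain ⟨a, haA, hac, had⟩ := hA (min r (δ * r / (4 * M + 1))) (by positivity)
        have har : a ∈ ball c r := had.trans_le (min_le_left _ _)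
        have had' := had.trans_le (min_le_right _ _)
        obtain ⟨N, hN⟩ := (Metric.tendsto_atTop.mp (hlim a haA har hac)) (δ / 2) (by positivity)
        refine ⟨N, fun n hn => ?_⟩
        have h1 := Complex.dist_le_div_mul_dist_of_mapsTo_ball (hg n) (hmaps n) har
        have h2 : 2 * M / r * dist a c ≤ δ / 2 := by
          calc 2 * M / r * dist a c ≤ 2 * M / r * (δ * r / (4 * M + 1)) := by gcongr
            _ = δ / 2 * (4 * M / (4 * M + 1)) := by field_simp; ring
            _ ≤ δ / 2 * 1 := by
                gcongr
                exact (div_le_one (by positivity)).mpr (by linarith)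
            _ = δ / 2 := mul_one _
        have h3 := dist_triangle (g n c) (g n a) 0
        have h4 := hN n hn.le
        rw [dist_comm] at h1
        linarith
      have hds := ih (2 * M / r) (fun n => dslope (g n) c)
        (fun n => (Complex.differentiableOn_dslope (ball_mem_nhds c hr)).mpr (hg n))
        (fun n y hy => Complex.norm_dslope_le_div_of_mapsTo_ball (hg n) (hmaps n) hy)
        (by
          intro a haA har hac
          have h1 : ∀ n, dslope (g n) c a = (a - c)⁻¹ * (g n a - g n c) := by
            intro n
            rw [dslope_of_ne _ hac, slope_def_module, smul_eq_mul]
          simp only [h1]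
          simpa using ((hlim a haA har hac).sub hcen).const_mul (a - c)⁻¹)
        (ε / (2 * r)) (by positivity)
      have hc2 : ∀ᶠ n in atTop, ‖g n c‖ < ε / 2 := by
        have := hcen.norm
        rw [norm_zero] at this
        exact this.eventually_lt_const (by positivity)
      filter_upwards [hds, hc2] with n h1 h2
      have h3 : g n z = g n c + (z - c) * dslope (g n) c z := by
        have := sub_smul_dslope (g n) c z
        rw [smul_eq_mul] at this
        rw [this]
        ring
      have hzr : dist z c ≤ r := (mem_ball.mp hz').le
      calc ‖g n z‖ ≤ ‖g n c‖ + dist z c * ‖dslope (g n) c z‖ := by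
            rw [h3, dist_eq_norm, ← norm_mul]
            exact norm_add_le _ _
        _ ≤ ε / 2 + dist z c * (2 * M / r * (2 * dist z c / r) ^ k + ε / (2 * r)) := by
            gcongr
        _ = M * (2 * dist z c / r) ^ (k + 1) + (ε / 2 + dist z c * (ε / (2 * r))) := by
            rw [pow_succ]; ring
        _ ≤ M * (2 * dist z c / r) ^ (k + 1) + (ε / 2 + r * (ε / (2 * r))) := by gcongr
        _ = M * (2 * dist z c / r) ^ (k + 1) + ε := by field_simp; ring
  have hq0 : 0 ≤ 2 * dist z c / r := by positivity
  have hq1 : 2 * dist z c / r < 1 := by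
    rw [div_lt_one hr]
    have := mem_ball.mp hz
    linarith
  rw [Metric.tendsto_atTop']
  intro ε hε
  have hpow := ((tendsto_pow_atTop_nhds_zero_of_lt_one hq0 hq1).const_mul M)
  rw [mul_zero] at hpow
  obtain ⟨k, hk⟩ := (hpow.eventually_lt_const (by positivity : (0 : ℝ) < ε / 2)).exists
  obtain ⟨N, hN⟩ := eventually_atTop.mp
    (main k M g hg hM (fun a h1 h2 _ => hlim a h1 h2) (ε / 2) (by positivity))
  refine ⟨N, fun n hn => ?_⟩
  rw [dist_zero_right]
  linarith [hN n hn.le]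

/-! ### The recursion for the partition functions. -/

/-- Effect on `(Z(G - v), Z(G))`, for a graph `G` rooted at `v`, of attaching a new root to `v`. -/
def legStep {R : Type*} [CommRing R] (x : R) (p : R × R) : R × R := (p.2, p.2 + x * p.1)

/-- The pair `(Z(T_d - root), Z(T_d))` as a function of the fugacity `x`. -/
def rootPair {R : Type*} [CommRing R] (k : ℕ) (x : R) : ℕ → R × R
  | 0 => (1, 1 + x)
  | d + 1 =>
    (((legStep x)^[2 * k] (rootPair k x d)).2 ^ 2,
      ((legStep x)^[2 * k] (rootPair k x d)).2 ^ 2 +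
        x * ((legStep x)^[2 * k] (rootPair k x d)).1 ^ 2)

section Algebra

variable {R S : Type*} [CommRing R] [CommRing S]

lemma legStep_iterate_map (φ : R →+* S) (x : R) (p : R × R) (m : ℕ) :
    (legStep (φ x))^[m] (φ p.1, φ p.2) =
      (φ ((legStep x)^[m] p).1, φ ((legStep x)^[m] p).2) := by
  induction m with
  | zero => rfl
  | succ m ih =>
    rw [Function.iterate_succ_apply', Function.iterate_succ_apply', ih]
    simp [legStep]

lemma rootPair_map (φ : R →+* S) (k : ℕ) (x : R) (d : ℕ) :
    rootPair k (φ x) d = (φ (rootPair k x d).1, φ (rootPair k x d).2) := by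
  induction d with
  | zero => simp [rootPair]
  | succ d ih => simp [rootPair, ih, legStep_iterate_map]

lemma legStep_iterate_eq (x : R) (p : R × R) (m : ℕ) :
    (legStep x)^[m] p =
      (p.1 * ((legStep x)^[m] (1, 0)).1 + p.2 * ((legStep x)^[m] (0, 1)).1,
        p.1 * ((legStep x)^[m] (1, 0)).2 + p.2 * ((legStep x)^[m] (0, 1)).2) := by
  induction m with
  | zero => simp
  | succ m ih =>
    simp only [Function.iterate_succ_apply']
    rw [ih]
    simp only [legStep, Prod.mk.injEq, true_and]
    ring

/-- One step has matrix with rows (0, 1), (x, 1), of determinant -x. -/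
lemma legStep_iterate_det (x : R) (m : ℕ) :
    ((legStep x)^[m] (1, 0)).1 * ((legStep x)^[m] (0, 1)).2 -
      ((legStep x)^[m] (1, 0)).2 * ((legStep x)^[m] (0, 1)).1 = (-x) ^ m := by
  induction m with
  | zero => simp
  | succ m ih =>
    simp only [Function.iterate_succ_apply', legStep]
    rw [pow_succ, ← ih]
    ring

end Algebra

/-! ### Ratios at positive fugacity: contraction and oscillation. -/

section RealDynamics

/-- The action of `legStep` on the ratio of the two components. -/
noncomputable def legRatio (x t : ℝ) : ℝ := 1 / (1 + x * t)

lemma legRatio_mem {x t : ℝ} (hx : 0 < x) (ht : 0 ≤ t) : legRatio x t ∈ Icc (0 : ℝ) 1 := by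
  have : 0 ≤ x * t := by positivity
  refine ⟨by unfold legRatio; positivity, ?_⟩
  rw [legRatio, div_le_one (by positivity)]
  linarith

lemma legRatio_iterate_mem {x t : ℝ} (hx : 0 < x) (ht : t ∈ Icc (0 : ℝ) 1) (m : ℕ) :
    (legRatio x)^[m] t ∈ Icc (0 : ℝ) 1 := by
  induction m with
  | zero => exact ht
  | succ m ih =>
    rw [Function.iterate_succ_apply']
    exact legRatio_mem hx ih.1

lemma legStep_iterate_ratio {x : ℝ} (hx : 0 < x) {p : ℝ × ℝ} (h1 : 0 < p.1) (h2 : 0 < p.2)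
    (m : ℕ) : 0 < ((legStep x)^[m] p).1 ∧ 0 < ((legStep x)^[m] p).2 ∧
      ((legStep x)^[m] p).1 / ((legStep x)^[m] p).2 = (legRatio x)^[m] (p.1 / p.2) := by
  induction m with
  | zero => exact ⟨h1, h2, rfl⟩
  | succ m ih =>
    obtain ⟨i1, i2, i3⟩ := ih
    simp only [Function.iterate_succ_apply']
    rw [← i3]
    refine ⟨i2, by unfold legStep; positivity, ?_⟩
    simp only [legStep, legRatio]
    field_simp

/-- The ratio of the components of `rootPair`. -/
noncomputable def rootRatio (k : ℕ) (x : ℝ) : ℕ → ℝ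
  | 0 => 1 / (1 + x)
  | d + 1 => 1 / (1 + x * ((legRatio x)^[2 * k] (rootRatio k x d)) ^ 2)

lemma rootRatio_mem (k : ℕ) {x : ℝ} (hx : 0 < x) (d : ℕ) : rootRatio k x d ∈ Icc (0 : ℝ) 1 := by
  cases d with
  | zero => simpa [legRatio, rootRatio] using legRatio_mem hx zero_le_one
  | succ d => exact legRatio_mem hx (sq_nonneg _)

lemma rootPair_pos (k : ℕ) {x : ℝ} (hx : 0 < x) (d : ℕ) :
    0 < (rootPair k x d).1 ∧ 0 < (rootPair k x d).2 ∧
      (rootPair k x d).1 / (rootPair k x d).2 = rootRatio k x d := by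
  induction d with
  | zero => simp only [rootPair, rootRatio]; exact ⟨one_pos, by positivity, trivial⟩
  | succ d ih =>
    obtain ⟨i1, i2, i3⟩ := ih
    obtain ⟨j1, j2, j3⟩ := legStep_iterate_ratio hx i1 i2 (2 * k)
    rw [i3] at j3
    simp only [rootPair, rootRatio]
    rw [← j3]
    refine ⟨by positivity, by positivity, ?_⟩
    field_simp

lemma abs_one_div_one_add_sub_le {a b : ℝ} (ha : 0 ≤ a) (hb : 0 ≤ b) :
    |1 / (1 + a) - 1 / (1 + b)| ≤ |a - b| := by
  have h : 1 / (1 + a) - 1 / (1 + b) = (b - a) / ((1 + a) * (1 + b)) := by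
    field_simp; ring
  rw [h, abs_div, abs_sub_comm b a, abs_of_pos (by positivity : 0 < (1 + a) * (1 + b))]
  apply div_le_self (abs_nonneg _)
  nlinarith [mul_nonneg ha hb]

lemma legRatio_iterate_sub_le {x : ℝ} (hx : 0 < x) (hx1 : x ≤ 1) {a b : ℝ}
    (ha : a ∈ Icc (0 : ℝ) 1) (hb : b ∈ Icc (0 : ℝ) 1) (m : ℕ) :
    |(legRatio x)^[m] a - (legRatio x)^[m] b| ≤ |a - b| := by
  induction m with
  | zero => exact le_rfl
  | succ m ih =>
    have h1 := (legRatio_iterate_mem hx ha m).1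
    have h2 := (legRatio_iterate_mem hx hb m).1
    simp only [Function.iterate_succ_apply']
    refine (abs_one_div_one_add_sub_le (by positivity) (by positivity)).trans ?_
    rw [← mul_sub, abs_mul, abs_of_pos hx]
    exact (mul_le_of_le_one_left (abs_nonneg _) hx1).trans ih

/-- The legs do not expand distances on [0, 1], and squaring at the branch vertex costs a factor 2,
so a level contracts by 2x ≤ 1/2. -/
lemma rootRatio_tendsto_of_le (k : ℕ) {x : ℝ} (hx : 0 < x) (hx1 : x ≤ 1 / 4) :
    Tendsto (fun d => rootRatio k x d - rootRatio k x (d + 1)) atTop (𝓝 0) := by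
  have hb : ∀ d, |rootRatio k x d - rootRatio k x (d + 1)| ≤ (1 / 2) ^ d := by
    intro d
    induction d with
    | zero =>
      have h1 := rootRatio_mem k hx 0
      have h2 := rootRatio_mem k hx 1
      rw [pow_zero, abs_le]
      constructor <;> linarith [h1.1, h1.2, h2.1, h2.2]
    | succ d ih =>
      have m1 := legRatio_iterate_mem hx (rootRatio_mem k hx d) (2 * k)
      have m2 := legRatio_iterate_mem hx (rootRatio_mem k hx (d + 1)) (2 * k)
      have h1 := legRatio_iterate_sub_le hx (by linarith) (rootRatio_mem k hx d)
        (rootRatio_mem k hx (d + 1)) (2 * k)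
      rw [rootRatio, rootRatio]
      set u := (legRatio x)^[2 * k] (rootRatio k x d)
      set v := (legRatio x)^[2 * k] (rootRatio k x (d + 1))
      have h2 : |u + v| ≤ 2 := by
        rw [abs_le]; constructor <;> linarith [m1.1, m1.2, m2.1, m2.2]
      calc |1 / (1 + x * u ^ 2) - 1 / (1 + x * v ^ 2)| ≤ |x * u ^ 2 - x * v ^ 2| :=
            abs_one_div_one_add_sub_le (by positivity) (by positivity)
        _ = x * |u + v| * |u - v| := by
            rw [← abs_of_pos hx, mul_assoc, ← abs_mul, ← abs_mul, abs_of_pos hx]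
            congr 1; ring
        _ ≤ 1 / 4 * 2 * (1 / 2) ^ d := by
            gcongr
            exact h1.trans ih
        _ = (1 / 2) ^ (d + 1) := by rw [pow_succ]; ring
  exact squeeze_zero_norm hb (tendsto_pow_atTop_nhds_zero_of_lt_one (by norm_num) (by norm_num))

lemma legRatio_le_of_ge {x t c : ℝ} (hx : 0 < x) (hc : 0 < c) (ht : 1 / c ≤ t) :
    legRatio x t ≤ c / x := by
  have h : 0 < 1 / c := by positivity
  have ht0 : 0 < t := h.trans_le ht
  have h1 : 1 ≤ t * c := (div_le_iff₀ hc).mp ht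
  rw [legRatio, div_le_div_iff₀ (by positivity) hx]
  nlinarith

lemma legRatio_ge_of_le {x t c : ℝ} (hx : 0 < x) (_hc : 0 < c) (ht0 : 0 ≤ t) (ht : t ≤ c / x) :
    1 / (1 + c) ≤ legRatio x t := by
  rw [le_div_iff₀ hx] at ht
  rw [legRatio]
  gcongr
  linarith

/-- `legRatio` exchanges ratios of order 1 and of order 1 / x. An even number of steps therefore
preserves the order, and each pair of steps only worsens the constant by 1. -/
lemma legRatio_two_mul_iterate_ge {x t : ℝ} (hx : 0 < x) {c : ℝ} (hc : 0 < c) (ht : 1 / c ≤ t)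
    (k : ℕ) : 1 / (c + k) ≤ (legRatio x)^[2 * k] t := by
  induction k with
  | zero => simpa using ht
  | succ k ih =>
    have h0 : 0 < 1 / (c + k) := by positivity
    rw [show 2 * (k + 1) = 2 * k + 1 + 1 by ring, Function.iterate_succ_apply',
      Function.iterate_succ_apply']
    have h1 := legRatio_le_of_ge hx (by positivity) ih
    have h2 := legRatio_ge_of_le hx (by positivity) (legRatio_mem hx (h0.le.trans ih)).1 h1
    refine le_trans (le_of_eq ?_) h2
    push_cast
    ring

lemma legRatio_two_mul_iterate_le {x t : ℝ} (hx : 0 < x) {c : ℝ} (hc : 0 < c) (ht0 : 0 ≤ t)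
    (ht : t ≤ c / x) (k : ℕ) :
    0 ≤ (legRatio x)^[2 * k] t ∧ (legRatio x)^[2 * k] t ≤ (c + k) / x := by
  induction k with
  | zero => simpa using ⟨ht0, ht⟩
  | succ k ih =>
    rw [show 2 * (k + 1) = 2 * k + 1 + 1 by ring, Function.iterate_succ_apply',
      Function.iterate_succ_apply']
    have h1 := legRatio_ge_of_le hx (by positivity) ih.1 ih.2
    have h2 := legRatio_le_of_ge hx (by positivity) h1
    refine ⟨(legRatio_mem hx (legRatio_mem hx ih.1).1).1, h2.trans (le_of_eq ?_)⟩
    push_cast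
    ring

/-- A ratio at most C / x becomes u ≤ (C + k) / x along the leg, so x u ^ 2 ≤ 1 and the next ratio
is at least 1/2. A ratio at least 1/2 becomes u ≥ 1 / (k + 2), so u ^ 2 ≥ 1 / C and the next ratio
is at most C / x. -/
lemma rootRatio_oscillates (k : ℕ) {x : ℝ} (hx : (((k : ℝ) + 2) ^ 2 + k) ^ 2 ≤ x) (d : ℕ) :
    rootRatio k x (2 * d) ≤ 1 / 4 ∧ 1 / 2 ≤ rootRatio k x (2 * d + 1) := by
  have hk : (0 : ℝ) ≤ k := Nat.cast_nonneg k
  set C : ℝ := ((k : ℝ) + 2) ^ 2 with hC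
  have hC4 : 4 ≤ C := by rw [hC]; nlinarith
  have hx0 : 0 < x := lt_of_lt_of_le (by positivity) hx
  have hCx : C / x ≤ 1 / 4 := by
    rw [div_le_div_iff₀ hx0 (by norm_num)]
    nlinarith [mul_nonneg hk (by linarith : (0 : ℝ) ≤ C)]
  have hodd : ∀ d, rootRatio k x d ≤ C / x → 1 / 2 ≤ rootRatio k x (d + 1) := by
    intro d hd
    obtain ⟨h0, h1⟩ := legRatio_two_mul_iterate_le hx0 (by linarith) (rootRatio_mem k hx0 d).1 hd k
    rw [rootRatio]
    set u := (legRatio x)^[2 * k] (rootRatio k x d)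
    have h2 : x * u ^ 2 ≤ 1 := by
      calc x * u ^ 2 ≤ x * ((C + k) / x) ^ 2 := by gcongr
        _ = (C + k) ^ 2 / x := by field_simp
        _ ≤ 1 := (div_le_one hx0).mpr hx
    rw [div_le_div_iff₀ (by norm_num) (by positivity)]
    linarith
  have heven : ∀ d, 1 / 2 ≤ rootRatio k x d → rootRatio k x (d + 1) ≤ C / x := by
    intro d hd
    have h1 := legRatio_two_mul_iterate_ge hx0 two_pos hd k
    rw [rootRatio]
    set u := (legRatio x)^[2 * k] (rootRatio k x d)
    refine legRatio_le_of_ge hx0 (by linarith) ?_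
    calc 1 / C = (1 / (2 + k)) ^ 2 := by rw [hC, div_pow, one_pow, add_comm]
      _ ≤ u ^ 2 := by gcongr
  have main : ∀ d, rootRatio k x (2 * d) ≤ C / x := by
    intro d
    induction d with
    | zero =>
      rw [mul_zero, rootRatio, div_le_div_iff₀ (by positivity) hx0]
      nlinarith
    | succ d ih => exact heven _ (hodd _ ih)
  exact ⟨(main d).trans hCx, hodd _ (main d)⟩

end RealDynamics

/-! ### Holomorphic ratios and the accumulation of zeros. -/

lemma differentiable_legStep_iterate {p : ℂ → ℂ × ℂ} (h1 : Differentiable ℂ fun x => (p x).1)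
    (h2 : Differentiable ℂ fun x => (p x).2) (m : ℕ) :
    (Differentiable ℂ fun x => ((legStep x)^[m] (p x)).1) ∧
      Differentiable ℂ fun x => ((legStep x)^[m] (p x)).2 := by
  induction m with
  | zero => exact ⟨h1, h2⟩
  | succ m ih =>
    simp only [Function.iterate_succ_apply', legStep]
    exact ⟨ih.2, ih.2.add (differentiable_id.mul ih.1)⟩

lemma differentiable_rootPair (k d : ℕ) :
    (Differentiable ℂ fun x : ℂ => (rootPair k x d).1) ∧
      Differentiable ℂ fun x : ℂ => (rootPair k x d).2 := by
  induction d with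
  | zero => simp only [rootPair]; constructor <;> fun_prop
  | succ d ih =>
    obtain ⟨h1, h2⟩ := differentiable_legStep_iterate ih.1 ih.2 (2 * k)
    simp only [rootPair]
    constructor <;> fun_prop

lemma rootPair_ofReal (k : ℕ) {x : ℝ} (hx : 0 < x) (d : ℕ) :
    (rootPair k (x : ℂ) d).2 ≠ 0 ∧
      (rootPair k (x : ℂ) d).1 / (rootPair k (x : ℂ) d).2 = (rootRatio k x d : ℂ) := by
  have h := rootPair_map Complex.ofRealHom k x d
  obtain ⟨-, h2, h3⟩ := rootPair_pos k hx d
  rw [Complex.ofRealHom_eq_coe] at h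
  rw [h]
  refine ⟨?_, ?_⟩
  · simpa using h2.ne'
  · rw [← h3]; simp

/-- The ratio `Z(T_d - root) / Z(T_d)` at fugacity `s ^ 2`. -/
noncomputable def occRatio (k d : ℕ) (s : ℂ) : ℂ :=
  (rootPair k (s ^ 2) d).1 / (rootPair k (s ^ 2) d).2

lemma occRatio_ofReal (k d : ℕ) {s : ℝ} (hs : 0 < s) :
    occRatio k d s = (rootRatio k (s ^ 2) d : ℂ) := by
  have := (rootPair_ofReal k (by positivity : 0 < s ^ 2) d).2
  rw [Complex.ofReal_pow] at this
  exact this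

lemma differentiableOn_occRatio (k d : ℕ) {U : Set ℂ}
    (hU : ∀ s ∈ U, (rootPair k (s ^ 2) d).2 ≠ 0) : DifferentiableOn ℂ (occRatio k d) U := by
  have h1 := (differentiable_rootPair k d).1.comp (differentiable_id.pow 2 : Differentiable ℂ _)
  have h2 := (differentiable_rootPair k d).2.comp (differentiable_id.pow 2 : Differentiable ℂ _)
  exact h1.differentiableOn.div h2.differentiableOn hU

/-- A linear form in the vector `p`; at `p = rootPair k (s ^ 2) d` the product of the forms with
parameters `s` and `-s` is the independence polynomial of `T_{d+1}` at `s ^ 2`. -/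
noncomputable def legForm (k : ℕ) (s : ℂ) (p : ℂ × ℂ) : ℂ :=
  ((legStep (s ^ 2))^[2 * k] p).2 + Complex.I * s * ((legStep (s ^ 2))^[2 * k] p).1

lemma legForm_eq (k : ℕ) (s : ℂ) (p : ℂ × ℂ) :
    legForm k s p = p.1 * legForm k s (1, 0) + p.2 * legForm k s (0, 1) := by
  rw [legForm, legStep_iterate_eq]
  simp only [legForm]
  ring

/-- B ^ 2 + s ^ 2 A ^ 2 = (B + isA)(B - isA); a holomorphic splitting is the reason for the variable
s with x = s ^ 2. -/
lemma legForm_mul_legForm_neg (k d : ℕ) (s : ℂ) :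
    legForm k s (rootPair k (s ^ 2) d) * legForm k (-s) (rootPair k (s ^ 2) d) =
      (rootPair k (s ^ 2) (d + 1)).2 := by
  simp only [legForm, rootPair, neg_sq]
  linear_combination -s ^ 2 * ((legStep (s ^ 2))^[2 * k] (rootPair k (s ^ 2) d)).1 ^ 2 *
    Complex.I_sq

lemma differentiable_legForm (k : ℕ) (p : ℂ × ℂ) : Differentiable ℂ fun s => legForm k s p := by
  obtain ⟨h1, h2⟩ := differentiable_legStep_iterate (p := fun _ => p) (by fun_prop) (by fun_prop)
    (2 * k)
  have h1' := h1.comp (differentiable_id.pow 2 : Differentiable ℂ _)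
  have h2' := h2.comp (differentiable_id.pow 2 : Differentiable ℂ _)
  exact h2'.add ((differentiable_id.const_mul Complex.I).mul h1')

/-- The two forms `legForm k s` and `legForm k (-s)` are independent. -/
lemma legForm_det (k : ℕ) (s : ℂ) :
    legForm k (-s) (1, 0) * legForm k s (0, 1) - legForm k s (1, 0) * legForm k (-s) (0, 1) =
      -2 * Complex.I * s * (s ^ 2) ^ (2 * k) := by
  have h := legStep_iterate_det (s ^ 2) (2 * k)
  rw [(even_two_mul k).neg_pow] at h
  simp only [legForm, neg_sq]
  rw [← h]
  ring

/-- `legForm` does not vanish at real vectors for a positive real parameter. -/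
lemma legForm_ofReal_ne_zero (k : ℕ) {s : ℝ} (hs : s ≠ 0) {p : ℝ × ℝ} (hp : p ≠ 0) :
    legForm k s ((p.1 : ℂ), (p.2 : ℂ)) ≠ 0 := by
  have h := legStep_iterate_map Complex.ofRealHom (s ^ 2) p (2 * k)
  simp only [Complex.ofRealHom_eq_coe, Complex.ofReal_pow] at h
  rw [legForm, h]
  set q := (legStep (s ^ 2))^[2 * k] p with hq
  intro h0
  have hre := congrArg Complex.re h0
  have him := congrArg Complex.im h0
  simp at hre him
  -- The real and imaginary parts of the form are q.2 and s q.1, so q = 0; p = 0 follows because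
  -- `legStep` has trivial kernel for s ≠ 0.
  have hq1 : q.1 = 0 := him.resolve_left hs
  have hinv : ∀ m, (legStep (s ^ 2))^[m] p = 0 → p = 0 := by
    intro m
    induction m with
    | zero => exact id
    | succ m ih =>
      intro hm
      apply ih
      rw [Function.iterate_succ_apply'] at hm
      have e1 : ((legStep (s ^ 2))^[m] p).2 = 0 := congrArg Prod.fst hm
      have e2 : ((legStep (s ^ 2))^[m] p).2 + s ^ 2 * ((legStep (s ^ 2))^[m] p).1 = 0 :=
        congrArg Prod.snd hm
      rw [e1, zero_add] at e2
      exact Prod.ext ((mul_eq_zero.mp e2).resolve_left (by positivity)) e1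
  exact hp (hinv _ (Prod.ext hq1 hre))

/-- If no `Z(T_d)` vanishes near `s₀ ^ 2 > 0`, then the ratios are locally uniformly bounded. -/
lemma occRatio_bounded (k : ℕ) {s₀ r₀ : ℝ} (hs₀ : 0 < s₀) (hr₀ : 0 < r₀)
    (hZ : ∀ s ∈ ball (s₀ : ℂ) r₀, ∀ d, (rootPair k (s ^ 2) d).2 ≠ 0) :
    ∃ ρ > 0, ρ ≤ r₀ ∧ ∃ M, ∀ d, ∀ s ∈ ball (s₀ : ℂ) ρ, ‖occRatio k d s‖ ≤ M := by
  set a : ℂ → ℂ := fun s => legForm k s (1, 0) with ha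
  set b : ℂ → ℂ := fun s => legForm k s (0, 1) with hb
  set a' : ℂ → ℂ := fun s => legForm k (-s) (1, 0) with ha'
  set b' : ℂ → ℂ := fun s => legForm k (-s) (0, 1) with hb'
  have hneg : Differentiable ℂ fun s : ℂ => -s := differentiable_neg
  have da : Differentiable ℂ a := differentiable_legForm k _
  have db : Differentiable ℂ b := differentiable_legForm k _
  have da' : Differentiable ℂ a' := (differentiable_legForm k _).comp hneg
  have db' : Differentiable ℂ b' := (differentiable_legForm k _).comp hneg
  set D : ℂ → ℂ := fun s => a' s * b s - a s * b' s with hD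
  have dD : Differentiable ℂ D := (da'.mul db).sub (da.mul db')
  have hD0 : D s₀ ≠ 0 := by
    have : D s₀ = _ := legForm_det k (s₀ : ℂ)
    rw [this]
    have : (s₀ : ℂ) ≠ 0 := by exact_mod_cast hs₀.ne'
    simp [this]
  have ha0 : a s₀ ≠ 0 := by
    simpa using legForm_ofReal_ne_zero k hs₀.ne' (p := (1, 0)) (by simp)
  have ha0' : a' s₀ ≠ 0 := by
    simpa using legForm_ofReal_ne_zero k (neg_ne_zero.mpr hs₀.ne') (p := (1, 0)) (by simp)
  have hev : ∀ᶠ s in 𝓝 (s₀ : ℂ), a s ≠ 0 ∧ a' s ≠ 0 ∧ D s ≠ 0 ∧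
      ‖D s / (a s * a' s)‖ < ‖D s₀ / (a s₀ * a' s₀)‖ + 1 ∧
      ‖b s / a s‖ < ‖b s₀ / a s₀‖ + 1 := by
    have c1 : ContinuousAt (fun s => ‖D s / (a s * a' s)‖) (s₀ : ℂ) :=
      ((dD _).continuousAt.div ((da _).continuousAt.mul (da' _).continuousAt)
        (mul_ne_zero ha0 ha0')).norm
    have c2 : ContinuousAt (fun s => ‖b s / a s‖) (s₀ : ℂ) :=
      ((db _).continuousAt.div (da _).continuousAt ha0).norm
    exact ((da _).continuousAt.eventually_ne ha0).and
      (((da' _).continuousAt.eventually_ne ha0').and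
      (((dD _).continuousAt.eventually_ne hD0).and
      ((c1.eventually_lt_const (lt_add_one _)).and (c2.eventually_lt_const (lt_add_one _)))))
  obtain ⟨r₁, hr₁, hball⟩ := Metric.eventually_nhds_iff_ball.mp hev
  set r := min r₀ r₁ with hr
  have hrpos : 0 < r := lt_min hr₀ hr₁
  have hZ' : ∀ s ∈ ball (s₀ : ℂ) r, ∀ d, (rootPair k (s ^ 2) d).2 ≠ 0 := fun s hs =>
    hZ s (ball_subset_ball (min_le_left _ _) hs)
  have hgood := fun s (hs : s ∈ ball (s₀ : ℂ) r) =>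
    hball s (ball_subset_ball (min_le_right _ _) hs)
  -- This moves the omitted values -b/a and -b'/a' of the ratio to 0 and 1, since G - 1 = a (a' R +
  -- b') / D.
  set G : ℕ → ℂ → ℂ := fun d s => a' s * (a s * occRatio k d s + b s) / D s with hG
  have hform : ∀ d, ∀ s ∈ ball (s₀ : ℂ) r,
      a s * occRatio k d s + b s ≠ 0 ∧ a' s * occRatio k d s + b' s ≠ 0 := by
    intro d s hs
    have h0 := hZ' s hs d
    have h1 := legForm_mul_legForm_neg k d s
    have h2 := hZ' s hs (d + 1)
    rw [← h1] at h2
    have e1 : a s * occRatio k d s + b s =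
        legForm k s (rootPair k (s ^ 2) d) / (rootPair k (s ^ 2) d).2 := by
      rw [legForm_eq k s (rootPair _ _ _), occRatio]
      field_simp
      ring
    have e2 : a' s * occRatio k d s + b' s =
        legForm k (-s) (rootPair k (s ^ 2) d) / (rootPair k (s ^ 2) d).2 := by
      rw [legForm_eq k (-s) (rootPair _ _ _), occRatio]
      field_simp
      ring
    rw [e1, e2]
    exact ⟨div_ne_zero (left_ne_zero_of_mul h2) h0, div_ne_zero (right_ne_zero_of_mul h2) h0⟩
  have hGd : ∀ d, DifferentiableOn ℂ (G d) (ball (s₀ : ℂ) r) := fun d =>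
    ((da'.differentiableOn.mul ((da.differentiableOn.mul
      (differentiableOn_occRatio k d fun s hs => hZ' s hs d)).add db.differentiableOn)).div
        dD.differentiableOn fun s hs => (hgood s hs).2.2.1)
  have hG01 : ∀ d, ∀ s ∈ ball (s₀ : ℂ) r, G d s ≠ 0 ∧ G d s ≠ 1 := by
    intro d s hs
    obtain ⟨g1, g2, g3, -⟩ := hgood s hs
    obtain ⟨f1, f2⟩ := hform d s hs
    refine ⟨div_ne_zero (mul_ne_zero g2 f1) g3, fun h => ?_⟩
    rw [hG, div_eq_one_iff_eq g3] at h
    apply mul_ne_zero g1 f2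
    simp only [hD] at h
    linear_combination h
  -- At the real centre the ratios lie in [0, 1], where the forms do not vanish, so compactness
  -- bounds the logarithm uniformly in d, as Schottky's theorem requires.
  obtain ⟨K, hK⟩ : ∃ K : ℝ, ∀ d, |Real.log ‖G d s₀‖| ≤ K := by
    have hcont : ContinuousOn (fun t : ℝ => |Real.log ‖a' s₀ * (a s₀ * t + b s₀) / D s₀‖|)
        (Icc 0 1) := by
      refine ContinuousOn.abs (ContinuousOn.log (by fun_prop) fun t _ => ?_)
      have h1 := legForm_ofReal_ne_zero k hs₀.ne' (p := (t, 1)) (by simp)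
      rw [legForm_eq] at h1
      have h2 : a s₀ * t + b s₀ ≠ 0 := by
        intro h
        apply h1
        refine Eq.trans ?_ h
        simp only [ha, hb, Complex.ofReal_one]
        ring
      exact norm_ne_zero_iff.mpr (div_ne_zero (mul_ne_zero ha0' h2) hD0)
    obtain ⟨K, hK⟩ := isCompact_Icc.bddAbove_image hcont
    refine ⟨K, fun d => ?_⟩
    have := hK (mem_image_of_mem _ (rootRatio_mem k (by positivity : 0 < s₀ ^ 2) d))
    simpa only [hG, occRatio_ofReal k d hs₀] using this
  obtain ⟨M, hM⟩ := schottky K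
  refine ⟨r / 2, by positivity, by linarith [min_le_left r₀ r₁],
    M * (‖D s₀ / (a s₀ * a' s₀)‖ + 1) + (‖b s₀ / a s₀‖ + 1), fun d s hs => ?_⟩
  have hs' : s ∈ ball (s₀ : ℂ) r := ball_subset_ball (by linarith) hs
  obtain ⟨g1, g2, g3, g4, g5⟩ := hgood s hs'
  have hGb := hM (G d) s₀ r hrpos (hGd d) (hG01 d) (hK d) s hs
  have hocc : occRatio k d s = G d s * (D s / (a s * a' s)) - b s / a s := by
    simp only [hG]
    field_simp
    ring
  rw [hocc]
  refine (norm_sub_le _ _).trans (add_le_add ?_ g5.le)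
  rw [norm_mul]
  exact mul_le_mul hGb g4.le (norm_nonneg _) ((norm_nonneg _).trans hGb)

/-- If no `Z(T_d)` vanishes near `s₀ ^ 2 > 0`, then convergence of the ratios propagates from the
left of `s₀` to the right of `s₀`. -/
lemma rootRatio_tendsto_propagates (k : ℕ) {s₀ r₀ : ℝ} (hs₀ : 0 < s₀) (hr₀ : 0 < r₀)
    (hZ : ∀ s ∈ ball (s₀ : ℂ) r₀, ∀ d, (rootPair k (s ^ 2) d).2 ≠ 0)
    (hlim : ∀ s, 0 < s → s < s₀ →
      Tendsto (fun d => rootRatio k (s ^ 2) d - rootRatio k (s ^ 2) (d + 1)) atTop (𝓝 0)) :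
    ∃ ρ > 0, ∀ s, s₀ ≤ s → s < s₀ + ρ →
      Tendsto (fun d => rootRatio k (s ^ 2) d - rootRatio k (s ^ 2) (d + 1)) atTop (𝓝 0) := by
  obtain ⟨ρ, hρ, hρr, M, hM⟩ := occRatio_bounded k hs₀ hr₀ hZ
  have hcast : ∀ s : ℝ, 0 < s →
      (Tendsto (fun d => rootRatio k (s ^ 2) d - rootRatio k (s ^ 2) (d + 1)) atTop (𝓝 0) ↔
        Tendsto (fun d => occRatio k d s - occRatio k (d + 1) s) atTop (𝓝 0)) := by
    intro s hs
    simp only [occRatio_ofReal k _ hs]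
    rw [← Complex.ofReal_zero, ← Filter.tendsto_ofReal_iff]
    simp
  have hdiff : ∀ d, DifferentiableOn ℂ (occRatio k d) (ball (s₀ : ℂ) ρ) := fun d =>
    differentiableOn_occRatio k d fun s hs => hZ s (ball_subset_ball hρr hs) d
  refine ⟨ρ / 2, by positivity, fun s hs1 hs2 => (hcast s (by linarith)).mpr ?_⟩
  refine tendsto_zero_of_bounded (A := Complex.ofReal '' Ioo 0 s₀) hρ ?_
    (g := fun d s => occRatio k d s - occRatio k (d + 1) s) (M := M + M)
    (fun d => (hdiff d).sub (hdiff (d + 1)))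
    (fun d s hs => (norm_sub_le _ _).trans (add_le_add (hM d s hs) (hM (d + 1) s hs))) ?_ ?_
  · intro ε hε
    obtain ⟨t, ht1, ht2⟩ := exists_between (max_lt hs₀ (sub_lt_self s₀ hε))
    rw [max_lt_iff] at ht1
    refine ⟨t, mem_image_of_mem _ ⟨ht1.1, ht2⟩, by exact_mod_cast ht2.ne, ?_⟩
    rw [Complex.dist_eq, ← Complex.ofReal_sub, Complex.norm_real, Real.norm_eq_abs, abs_lt]
    constructor <;> linarith
  · rintro _ ⟨t, ht, rfl⟩ -
    exact (hcast t ht.1).mp (hlim t ht.1 ht.2)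
  · rw [mem_ball, Complex.dist_eq, ← Complex.ofReal_sub, Complex.norm_real, Real.norm_eq_abs,
      abs_lt]
    constructor <;> linarith

/-- The zeros of the polynomials `(rootPair k z d).2` accumulate on the positive real axis. -/
theorem exists_accPt_rootPair_zeros (k : ℕ) :
    ∃ x : ℝ, 0 < x ∧ AccPt (x : ℂ) (𝓟 {z : ℂ | ∃ d, (rootPair k z d).2 = 0}) := by
  by_contra! hno
  have hfree : ∀ s₀ : ℝ, 0 < s₀ →
      ∃ r₀ > 0, ∀ s ∈ ball (s₀ : ℂ) r₀, ∀ d, (rootPair k (s ^ 2) d).2 ≠ 0 := by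
    intro s₀ hs₀
    have h := hno (s₀ ^ 2) (by positivity)
    rw [accPt_iff_frequently, not_frequently] at h
    have h1 : ∀ᶠ z in 𝓝 (((s₀ ^ 2 : ℝ)) : ℂ), ∀ d, (rootPair k z d).2 ≠ 0 := by
      filter_upwards [h] with z hz d hd
      -- Non-accumulation says nothing about the point itself, but Z is positive there.
      by_cases he : z = ((s₀ ^ 2 : ℝ) : ℂ)
      · rw [he] at hd
        exact (rootPair_ofReal k (by positivity) d).1 hd
      · exact hz ⟨he, d, hd⟩
    have hc : Tendsto (fun s : ℂ => s ^ 2) (𝓝 (s₀ : ℂ)) (𝓝 (((s₀ ^ 2 : ℝ)) : ℂ)) := by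
      rw [Complex.ofReal_pow]
      exact (continuous_pow 2).tendsto _
    exact Metric.eventually_nhds_iff_ball.mp (hc.eventually h1)
  set P : ℝ → Prop := fun s =>
    Tendsto (fun d => rootRatio k (s ^ 2) d - rootRatio k (s ^ 2) (d + 1)) atTop (𝓝 0) with hP
  have hsmall : ∀ s, 0 < s → s ≤ 1 / 2 → P s := fun s hs hs' =>
    rootRatio_tendsto_of_le k (by positivity) (by nlinarith)
  -- Continuation along the axis: convergence holds to the left of the infimum of the bad
  -- parameters, hence also slightly to its right.
  have hall : ∀ s, 0 < s → P s := by
    by_contra! hex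
    obtain ⟨b, hb, hPb⟩ := hex
    set B : Set ℝ := {s | 0 < s ∧ ¬ P s} with hB
    have hBlow : ∀ s ∈ B, 1 / 2 ≤ s := fun s hs => by
      by_contra hlt
      exact hs.2 (hsmall s hs.1 (not_le.mp hlt).le)
    have hne : B.Nonempty := ⟨b, hb, hPb⟩
    have hbdd : BddBelow B := ⟨1 / 2, hBlow⟩
    have hinf : 1 / 2 ≤ sInf B := le_csInf hne hBlow
    have hpos : 0 < sInf B := by linarith
    have hleft : ∀ s, 0 < s → s < sInf B → P s := fun s hs hlt => by
      by_contra hn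
      exact (csInf_le hbdd ⟨hs, hn⟩).not_gt hlt
    obtain ⟨r₀, hr₀, hZ⟩ := hfree _ hpos
    obtain ⟨ρ, hρ, hright⟩ := rootRatio_tendsto_propagates k hpos hr₀ hZ hleft
    have : sInf B + ρ ≤ sInf B := by
      refine le_csInf hne fun s hs => ?_
      by_contra hlt
      rw [not_le] at hlt
      rcases lt_or_ge s (sInf B) with h | h
      · exact hs.2 (hleft s hs.1 h)
      · exact hs.2 (hright s h hlt)
    linarith
  -- The parameter s = (k + 2) ^ 2 + k has s ^ 2 exactly at the oscillation threshold.
  have hosc := rootRatio_oscillates k (le_refl ((((k : ℝ) + 2) ^ 2 + k) ^ 2))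
  have hlim := hall (((k : ℝ) + 2) ^ 2 + k) (by positivity)
  obtain ⟨N, hN⟩ := Metric.tendsto_atTop.mp hlim (1 / 4) (by norm_num)
  have h1 := hN (2 * N) (by linarith)
  obtain ⟨h2, h3⟩ := hosc N
  rw [dist_zero_right, Real.norm_eq_abs, abs_lt] at h1
  linarith [h1.1]

/-! ### Deletion and product rules for the independence polynomial. -/

section IndependentSets

open Classical in
/-- The independence polynomial of the subgraph of `G` induced on the finite set `A`. -/
noncomputable def indepZOn {X : Type*} (G : SimpleGraph X) (z : ℂ) (A : Finset X) : ℂ :=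
  ∑ S ∈ A.powerset, if G.IsIndepSet (S : Set X) then z ^ S.card else 0

variable {X Y : Type*} {G : SimpleGraph X} {z : ℂ}

lemma indepZ_eq_indepZOn [Fintype X] : indepZ G (fun _ => z) = indepZOn G z Finset.univ := by
  classical
  rw [indepZ, indepZOn, Finset.sum_filter, Finset.powerset_univ]
  -- In `indepZ` the summation variable is elaborated as a `Set`, so the index set is `univ` pushed
  -- forward along the coercion from `Finset`.
  have himg : ((Finset.univ : Finset (Finset X)) >>= fun S => (pure (S : Set X))) =
      Finset.univ.image fun S : Finset X => (S : Set X) := by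
    change Finset.univ.sup (fun S : Finset X => ({(S : Set X)} : Finset (Set X))) = _
    ext S
    simp [eq_comm]
  rw [himg, Finset.sum_image fun S _ T _ h => Finset.coe_injective h]
  refine Finset.sum_congr rfl fun S _ => ?_
  simp only [Finset.prod_const, Finset.toFinset_coe]

lemma indepZOn_empty : indepZOn G z ∅ = 1 := by
  simp [indepZOn]

lemma indepZOn_image [DecidableEq Y] {G' : SimpleGraph Y} {A : Finset X} {φ : X → Y}
    (hφ : Function.Injective φ)
    (hadj : ∀ x ∈ A, ∀ y ∈ A, G'.Adj (φ x) (φ y) ↔ G.Adj x y) :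
    indepZOn G' z (A.image φ) = indepZOn G z A := by
  classical
  symm
  unfold indepZOn
  refine Finset.sum_bij (fun S _ => S.image φ) ?_ ?_ ?_ ?_
  · intro S hS
    rw [Finset.mem_powerset] at *
    exact Finset.image_subset_image hS
  · intro S _ T _ h
    exact Finset.image_injective hφ h
  · intro T hT
    rw [Finset.mem_powerset, Finset.subset_image_iff] at hT
    obtain ⟨S, hS, rfl⟩ := hT
    exact ⟨S, by simpa using hS, rfl⟩
  · intro S hS
    rw [Finset.mem_powerset] at hS
    rw [Finset.card_image_of_injective _ hφ]
    congr 1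
    rw [Finset.coe_image, SimpleGraph.isIndepSet_iff, SimpleGraph.isIndepSet_iff,
      hφ.injOn.pairwise_image, eq_iff_iff]
    refine ⟨fun h x hx y hy hxy => ?_, fun h x hx y hy hxy => ?_⟩
    · have := h hx hy hxy
      rwa [Function.onFun, hadj x (hS hx) y (hS hy)]
    · have := h hx hy hxy
      rwa [Function.onFun, hadj x (hS hx) y (hS hy)] at this

open Classical in
-- Independent sets are split by whether they contain v; those that do avoid its neighbours.
lemma indepZOn_insert [DecidableEq X] {v : X} {A : Finset X} (hv : v ∉ A) :
    indepZOn G z (insert v A) =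
      indepZOn G z A + z * indepZOn G z (A.filter fun u => ¬ G.Adj v u) := by
  unfold indepZOn
  rw [Finset.sum_powerset_insert hv, Finset.mul_sum]
  congr 1
  have hsub : (A.filter fun u => ¬ G.Adj v u).powerset ⊆ A.powerset :=
    Finset.powerset_mono.mpr (Finset.filter_subset _ _)
  rw [← Finset.sum_subset hsub]
  · refine Finset.sum_congr rfl fun S hS => ?_
    rw [Finset.mem_powerset] at hS
    have hvS : v ∉ S := fun h => hv (Finset.mem_filter.mp (hS h)).1
    have hiff : G.IsIndepSet ((insert v S : Finset X) : Set X) ↔ G.IsIndepSet (S : Set X) := by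
      rw [Finset.coe_insert, SimpleGraph.isIndepSet_iff, SimpleGraph.isIndepSet_iff,
        Set.pairwise_insert]
      refine ⟨fun h => h.1, fun h => ⟨h, fun u hu _ => ?_⟩⟩
      have := (Finset.mem_filter.mp (hS hu)).2
      exact ⟨this, fun h' => this h'.symm⟩
    rw [Finset.card_insert_of_notMem hvS, pow_succ']
    simp only [hiff, mul_ite, mul_zero]
  · intro S hS hS'
    rw [Finset.mem_powerset] at hS hS'
    rw [if_neg]
    intro hind
    apply hS'
    intro u hu
    refine Finset.mem_filter.mpr ⟨hS hu, ?_⟩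
    refine hind (by simp) (by simp [hu]) ?_
    rintro rfl
    exact hv (hS hu)

open Classical in
lemma indepZOn_union [DecidableEq X] {A B : Finset X} (hdisj : Disjoint A B)
    (hadj : ∀ x ∈ A, ∀ y ∈ B, ¬ G.Adj x y) :
    indepZOn G z (A ∪ B) = indepZOn G z A * indepZOn G z B := by
  induction A using Finset.strongInduction with
  | H A ih =>
    rcases A.eq_empty_or_nonempty with rfl | ⟨v, hv⟩
    · rw [Finset.empty_union, indepZOn_empty, one_mul]
    · obtain ⟨A', hvA', rfl⟩ : ∃ A', v ∉ A' ∧ insert v A' = A :=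
        ⟨A.erase v, Finset.notMem_erase _ _, Finset.insert_erase hv⟩
      have hvB : v ∉ B := Finset.disjoint_left.mp hdisj hv
      have hss := Finset.ssubset_insert hvA'
      have hsub : ∀ C ⊆ A', indepZOn G z (C ∪ B) = indepZOn G z C * indepZOn G z B := by
        intro C hC
        exact ih C (lt_of_le_of_lt hC hss)
          (hdisj.mono_left (hC.trans hss.1)) fun x hx => hadj x (hss.1 (hC hx))
      have hfil : (A' ∪ B).filter (fun u => ¬ G.Adj v u) =
          (A'.filter fun u => ¬ G.Adj v u) ∪ B := by
        rw [Finset.filter_union, Finset.filter_true_of_mem (s := B)]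
        exact hadj v hv
      rw [Finset.insert_union, indepZOn_insert (by simp [hvA', hvB]), hfil, indepZOn_insert hvA',
        hsub _ subset_rfl, hsub _ (Finset.filter_subset _ _)]
      ring

end IndependentSets

/-! ### The independence polynomial of the trees satisfies the recursion. -/

section TreePolynomial

/-- The relation `IsParent`, on all pairs of a binary word and a natural number. -/
def WordParent (k : ℕ) (x y : List Bool × ℕ) : Prop :=
  (x.1 = y.1 ∧ y.2 = x.2 + 1) ∨ (x.2 = 2 * k ∧ y.2 = 0 ∧ ∃ b : Bool, x.1 = y.1 ++ [b])

/-- The infinite forest of which every `tree k d` is an induced subgraph. -/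
def wordGraph (k : ℕ) : SimpleGraph (List Bool × ℕ) :=
  SimpleGraph.fromRel (WordParent k)

/-- Prefix a letter to a word. -/
def prefixWord (b : Bool) (x : List Bool × ℕ) : List Bool × ℕ := (b :: x.1, x.2)

lemma prefixWord_injective (b : Bool) : Function.Injective (prefixWord b) := by
  rintro ⟨w, i⟩ ⟨w', i'⟩ h
  simpa [prefixWord] using h

lemma wordParent_prefixWord {k : ℕ} {b : Bool} {x y : List Bool × ℕ} :
    WordParent k (prefixWord b x) (prefixWord b y) ↔ WordParent k x y := by
  simp [WordParent, prefixWord]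

lemma wordGraph_adj_prefixWord {k : ℕ} {b : Bool} {x y : List Bool × ℕ} :
    (wordGraph k).Adj (prefixWord b x) (prefixWord b y) ↔ (wordGraph k).Adj x y := by
  simp [wordGraph, SimpleGraph.fromRel_adj, wordParent_prefixWord,
    (prefixWord_injective b).ne_iff]

/-- Add the first `n` vertices of the edge above the root to `B`. -/
def addStem (B : Finset (List Bool × ℕ)) : ℕ → Finset (List Bool × ℕ)
  | 0 => B
  | n + 1 => insert ([], n) (addStem B n)

/-- All vertices of `tree k d` other than the root. -/
def belowRoot (k : ℕ) : ℕ → Finset (List Bool × ℕ)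
  | 0 => ∅
  | d + 1 => (addStem (belowRoot k d) (2 * k + 1)).image (prefixWord true) ∪
      (addStem (belowRoot k d) (2 * k + 1)).image (prefixWord false)

lemma mem_addStem {B : Finset (List Bool × ℕ)} {n : ℕ} {x : List Bool × ℕ} :
    x ∈ addStem B n ↔ x ∈ B ∨ (x.1 = [] ∧ x.2 < n) := by
  induction n with
  | zero => simp [addStem]
  | succ n ih =>
    obtain ⟨w, i⟩ := x
    rw [addStem, Finset.mem_insert, ih, Prod.mk.injEq]
    dsimp only
    rw [Order.lt_add_one_iff, le_iff_eq_or_lt]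
    tauto

lemma mem_belowRoot {k d : ℕ} {x : List Bool × ℕ} :
    x ∈ belowRoot k d ↔ x.1 ≠ [] ∧ x.1.length ≤ d ∧ x.2 < 2 * k + 1 := by
  induction d generalizing x with
  | zero =>
    simp only [belowRoot, Finset.notMem_empty, Nat.le_zero, List.length_eq_zero_iff, false_iff]
    tauto
  | succ d ih =>
    obtain ⟨w, i⟩ := x
    simp only [belowRoot, Finset.mem_union, Finset.mem_image, mem_addStem, ih, prefixWord]
    constructor
    · rintro (⟨⟨w', i'⟩, h, he⟩ | ⟨⟨w', i'⟩, h, he⟩) <;>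
      · rw [Prod.mk.injEq] at he
        obtain ⟨rfl, rfl⟩ := he
        rcases h with h | h
        · exact ⟨by simp, by simpa using h.2.1, h.2.2⟩
        · exact ⟨by simp, by simp [show w' = [] from h.1], h.2⟩
    · rintro ⟨h1, h2, h3⟩
      obtain ⟨b, w', rfl⟩ := List.exists_cons_of_ne_nil h1
      have hw : (w' ≠ [] ∧ w'.length ≤ d ∧ i < 2 * k + 1) ∨ (w' = [] ∧ i < 2 * k + 1) := by
        simp only [List.length_cons] at h2
        by_cases hw : w' = []
        · exact Or.inr ⟨hw, h3⟩
        · exact Or.inl ⟨hw, by omega, h3⟩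
      cases b
      · exact Or.inr ⟨(w', i), hw, rfl⟩
      · exact Or.inl ⟨(w', i), hw, rfl⟩

lemma wordGraph_adj_nil_succ {k n : ℕ} {x : List Bool × ℕ} (hx : x.1 = [] → x.2 < n + 1) :
    (wordGraph k).Adj ([], n + 1) x ↔ x = ([], n) := by
  obtain ⟨w, i⟩ := x
  simp only [wordGraph, SimpleGraph.fromRel_adj, WordParent] at *
  constructor
  · rintro ⟨-, (⟨h1, h2⟩ | ⟨-, -, b, h⟩) | (⟨h1, h2⟩ | ⟨-, h, -⟩)⟩
    · have := hx h1.symm; omega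
    · simp at h
    · simp only [h1, Prod.mk.injEq, true_and]; omega
    · omega
  · intro h
    rw [Prod.mk.injEq] at h
    obtain ⟨rfl, rfl⟩ := h
    exact ⟨by simp, Or.inr (Or.inl (by simp))⟩

lemma wordGraph_adj_nil_zero {k : ℕ} {b : Bool} {x : List Bool × ℕ} :
    (wordGraph k).Adj ([], 0) (prefixWord b x) ↔ x = ([], 2 * k) := by
  obtain ⟨w, i⟩ := x
  simp only [wordGraph, SimpleGraph.fromRel_adj, WordParent, prefixWord]
  constructor
  · rintro ⟨-, (⟨h1, h2⟩ | ⟨-, -, b, h⟩) | (⟨h1, h2⟩ | ⟨h1, -, b', h⟩)⟩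
    · simp at h1
    · simp at h
    · simp at h1
    · simp at h
      simp [h1, h.2]
  · intro h
    rw [Prod.mk.injEq] at h
    obtain ⟨rfl, rfl⟩ := h
    exact ⟨by simp, Or.inr (Or.inr ⟨rfl, trivial, b, rfl⟩)⟩

lemma nil_notMem_addStem_belowRoot {k d n : ℕ} : ([], n) ∉ addStem (belowRoot k d) n := by
  simp [mem_addStem, mem_belowRoot]

/-- The top vertex ([], n + 1) of the stem has ([], n) as its only neighbour in the set, so deletion
at the top vertex is one `legStep`. The vertex ([], 0) is the root itself, hence the offset by one.
-/
lemma indepZOn_addStem (k d : ℕ) (z : ℂ) (n : ℕ) :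
    (indepZOn (wordGraph k) z (addStem (belowRoot k d) n),
      indepZOn (wordGraph k) z (addStem (belowRoot k d) (n + 1))) =
    (legStep z)^[n] (indepZOn (wordGraph k) z (belowRoot k d),
      indepZOn (wordGraph k) z (addStem (belowRoot k d) 1)) := by
  classical
  induction n with
  | zero => rfl
  | succ n ih =>
    rw [Function.iterate_succ_apply', ← ih]
    have hfil : ((addStem (belowRoot k d) (n + 1)).filter
        fun u => ¬ (wordGraph k).Adj ([], n + 1) u) = addStem (belowRoot k d) n := by
      ext x
      rw [Finset.mem_filter]
      constructor
      · rintro ⟨h1, h2⟩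
        rw [wordGraph_adj_nil_succ] at h2
        · rw [addStem, Finset.mem_insert] at h1
          exact h1.resolve_left h2
        · rintro hx
          rw [mem_addStem, mem_belowRoot] at h1
          rcases h1 with h1 | h1
          · exact absurd hx h1.1
          · exact h1.2
      · intro h
        have h1 : x ∈ addStem (belowRoot k d) (n + 1) := by
          rw [addStem]; exact Finset.mem_insert_of_mem h
        refine ⟨h1, ?_⟩
        rw [wordGraph_adj_nil_succ]
        · rintro rfl
          exact nil_notMem_addStem_belowRoot h
        · intro hx
          rw [mem_addStem, mem_belowRoot] at h1
          rcases h1 with h1 | h1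
          · exact absurd hx h1.1
          · exact h1.2
    rw [show addStem (belowRoot k d) (n + 1 + 1) =
      insert ([], n + 1) (addStem (belowRoot k d) (n + 1)) from rfl,
      indepZOn_insert nil_notMem_addStem_belowRoot, hfil]
    rfl

/-- Two copies of `L` under a common root do not interact. -/
lemma indepZOn_two_copies (k : ℕ) (z : ℂ) (L : Finset (List Bool × ℕ)) :
    indepZOn (wordGraph k) z (L.image (prefixWord true) ∪ L.image (prefixWord false)) =
      indepZOn (wordGraph k) z L ^ 2 := by
  have himg : ∀ b, indepZOn (wordGraph k) z (L.image (prefixWord b)) =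
      indepZOn (wordGraph k) z L := fun b =>
    indepZOn_image (prefixWord_injective b) fun x _ y _ => wordGraph_adj_prefixWord
  have hdisj : Disjoint (L.image (prefixWord true)) (L.image (prefixWord false)) := by
    rw [Finset.disjoint_left]
    intro x hx hy
    obtain ⟨u, -, rfl⟩ := Finset.mem_image.mp hx
    obtain ⟨v, -, h⟩ := Finset.mem_image.mp hy
    simp [prefixWord] at h
  have hadj : ∀ x ∈ L.image (prefixWord true), ∀ y ∈ L.image (prefixWord false),
      ¬ (wordGraph k).Adj x y := by
    intro x hx y hy
    obtain ⟨u, -, rfl⟩ := Finset.mem_image.mp hx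
    obtain ⟨v, -, rfl⟩ := Finset.mem_image.mp hy
    simp [wordGraph, SimpleGraph.fromRel_adj, WordParent, prefixWord]
  have h := indepZOn_union (z := z) hdisj hadj
  rw [himg, himg, ← sq] at h
  convert h

lemma indepZOn_eq_rootPair (k : ℕ) (z : ℂ) (d : ℕ) :
    (indepZOn (wordGraph k) z (belowRoot k d),
      indepZOn (wordGraph k) z (addStem (belowRoot k d) 1)) = rootPair k z d := by
  classical
  have hroot : ∀ d, indepZOn (wordGraph k) z (addStem (belowRoot k d) 1) =
      indepZOn (wordGraph k) z (belowRoot k d) + z * indepZOn (wordGraph k) z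
        ((belowRoot k d).filter fun u => ¬ (wordGraph k).Adj ([], 0) u) := fun d =>
    indepZOn_insert (nil_notMem_addStem_belowRoot (n := 0))
  induction d with
  | zero => rw [hroot, rootPair]; simp [belowRoot, indepZOn_empty]
  | succ d ih =>
    have hleg := indepZOn_addStem k d z (2 * k)
    rw [ih] at hleg
    -- Occupying the root removes the top vertex ([], 2k) of both stems, leaving two copies of the
    -- shorter stem.
    have hfil : ((belowRoot k (d + 1)).filter fun u => ¬ (wordGraph k).Adj ([], 0) u) =
        (addStem (belowRoot k d) (2 * k)).image (prefixWord true) ∪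
          (addStem (belowRoot k d) (2 * k)).image (prefixWord false) := by
      have hb : ∀ b, ((addStem (belowRoot k d) (2 * k + 1)).image (prefixWord b)).filter
          (fun u => ¬ (wordGraph k).Adj ([], 0) u) =
          (addStem (belowRoot k d) (2 * k)).image (prefixWord b) := by
        intro b
        rw [Finset.filter_image]
        congr 1
        ext x
        rw [Finset.mem_filter, wordGraph_adj_nil_zero, addStem, Finset.mem_insert]
        constructor
        · rintro ⟨h1, h2⟩
          exact h1.resolve_left h2
        · intro h
          refine ⟨Or.inr h, ?_⟩
          rintro rfl
          exact nil_notMem_addStem_belowRoot h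
      rw [belowRoot, Finset.filter_union, hb, hb]
    rw [hroot, hfil, belowRoot, indepZOn_two_copies, indepZOn_two_copies, rootPair, ← hleg]

/-- The vertices of `tree k d` as pairs of a word and a natural number. -/
def TreeVertex.toWord {k d : ℕ} (x : TreeVertex k d) : List Bool × ℕ := (x.1.1, x.1.2)

lemma TreeVertex.toWord_injective {k d : ℕ} :
    Function.Injective (TreeVertex.toWord : TreeVertex k d → _) := by
  intro x y h
  simp only [TreeVertex.toWord, Prod.mk.injEq] at h
  exact Subtype.ext (Prod.ext h.1 (Fin.ext h.2))

lemma tree_adj_iff {k d : ℕ} {x y : TreeVertex k d} :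
    (tree k d).Adj x y ↔ (wordGraph k).Adj x.toWord y.toWord := by
  simp only [tree, wordGraph, SimpleGraph.fromRel_adj, TreeVertex.toWord_injective.ne_iff]
  rfl

theorem indepZ_tree (k d : ℕ) (z : ℂ) :
    indepZ (tree k d) (fun _ => z) = (rootPair k z d).2 := by
  rw [← indepZOn_eq_rootPair, indepZ_eq_indepZOn,
    ← indepZOn_image (G' := wordGraph k) (TreeVertex.toWord_injective (k := k) (d := d))
      fun x _ y _ => tree_adj_iff.symm]
  dsimp only
  congr 1
  ext ⟨w, i⟩
  rw [Finset.mem_image, mem_addStem, mem_belowRoot]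
  constructor
  · rintro ⟨⟨⟨w', i'⟩, h1, h2⟩, -, he⟩
    simp only [TreeVertex.toWord, Prod.mk.injEq] at he
    obtain ⟨rfl, rfl⟩ := he
    by_cases hw : w' = []
    · exact Or.inr ⟨hw, by simp [show i' = 0 from h2 hw]⟩
    · exact Or.inl ⟨hw, h1, i'.2⟩
  · intro h
    have hi : i < 2 * k + 1 := by
      rcases h with h | h
      · exact h.2.2
      · have := h.2; dsimp only at this; omega
    refine ⟨⟨(w, ⟨i, hi⟩), ?_, ?_⟩, Finset.mem_univ _, rfl⟩
    · rcases h with h | h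
      · exact h.2.1
      · simp [show w = [] from h.1]
    · intro hw
      rcases h with h | h
      · exact absurd hw h.1
      · exact Fin.ext (by have := h.2; dsimp only at this ⊢; simp; omega)

end TreePolynomial

/-! ### General facts on ranks, embeddings and walks. -/

section General

variable {V W : Type*}

/-- A graph with a rank function such that every vertex has at most one neighbour of smaller or
equal rank is acyclic. -/
lemma isAcyclic_of_rank {G : SimpleGraph V} {α : Type*} [LinearOrder α] (rank : V → α)
    (h : ∀ v a b, G.Adj v a → G.Adj v b → rank a ≤ rank v → rank b ≤ rank v → a = b) :
    G.IsAcyclic := by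
  classical
  intro v c hc
  -- At a vertex of maximal rank on a cycle both cycle neighbours have no larger rank, so they would
  -- coincide.
  obtain ⟨x, hx, hmax⟩ := c.support.toFinset.exists_max_image rank ⟨v, by simp⟩
  rw [List.mem_toFinset] at hx
  have hc' := hc.rotate hx
  have hmem : ∀ i, rank ((c.rotate x hx).getVert i) ≤ rank x := by
    intro i
    apply hmax
    rw [List.mem_toFinset]
    have h1 := (c.rotate x hx).getVert_mem_support i
    rwa [SimpleGraph.Walk.mem_support_rotate_iff] at h1
  exact hc'.snd_ne_penultimate (h x _ _ (SimpleGraph.Walk.adj_snd hc'.not_nil)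
    (SimpleGraph.Walk.adj_penultimate hc'.not_nil).symm (hmem _) (hmem _))

lemma degree_le_degree_of_embedding {H : SimpleGraph V} {G : SimpleGraph W} (e : H ↪g G) (v : V)
    [Fintype (H.neighborSet v)] [Fintype (G.neighborSet (e v))] :
    H.degree v ≤ G.degree (e v) := by
  rw [← SimpleGraph.card_neighborFinset_eq_degree, ← SimpleGraph.card_neighborFinset_eq_degree]
  refine Finset.card_le_card_of_injOn e ?_ e.injective.injOn
  intro u hu
  simpa using hu

/-- A function that changes by at most one along edges bounds the length of walks. -/
lemma le_add_length_of_lipschitz {G : SimpleGraph V} {ψ : V → ℕ}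
    (h : ∀ a b, G.Adj a b → ψ b ≤ ψ a + 1) {u v : V} (p : G.Walk u v) :
    ψ v ≤ ψ u + p.length := by
  induction p with
  | nil => simp
  | cons hadj p ih =>
    have := h _ _ hadj
    rw [SimpleGraph.Walk.length_cons]
    omega

end General

/-! ### Degrees, distances and freeness of T_{k,d}. -/

section Tree

variable {k d : ℕ}

lemma TreeVertex.ext {x y : TreeVertex k d} (h1 : x.1.1 = y.1.1) (h2 : (x.1.2 : ℕ) = y.1.2) :
    x = y :=
  Subtype.ext (Prod.ext h1 (Fin.ext h2))

lemma isParent_unique {x y z : TreeVertex k d} (hy : IsParent x y) (hz : IsParent x z) :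
    y = z := by
  obtain ⟨⟨w, i⟩, hx⟩ := x
  obtain ⟨⟨w₁, i₁⟩, h₁⟩ := y
  obtain ⟨⟨w₂, i₂⟩, h₂⟩ := z
  have b₁ := i₁.2
  have b₂ := i₂.2
  simp only [IsParent] at hy hz
  rcases hy with ⟨rfl, e₁⟩ | ⟨e₁, e₁', b, rfl⟩ <;> rcases hz with ⟨e₂', e₂⟩ | ⟨e₂, e₂', c, e₃⟩
  · exact TreeVertex.ext e₂' (by dsimp only; omega)
  · omega
  · omega
  · exact TreeVertex.ext (by simpa using congrArg List.dropLast e₃) (by dsimp only; omega)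

lemma tree_adj {x y : TreeVertex k d} : (tree k d).Adj x y ↔ IsParent x y ∨ IsParent y x := by
  rw [tree, SimpleGraph.fromRel_adj, and_iff_right_iff_imp]
  rintro h rfl
  simp [IsParent] at h

theorem tree_isAcyclic (k d : ℕ) : (tree k d).IsAcyclic := by
  -- The rank is the distance to the root; it drops by one towards the parent, so only the parent
  -- has rank at most that of the vertex.
  have key : ∀ x y : TreeVertex k d, IsParent x y →
      ((2 * k + 1) * y.1.1.length - (y.1.2 : ℕ) : ℤ) + 1 =
        (2 * k + 1) * x.1.1.length - (x.1.2 : ℕ) := by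
    rintro x y (⟨h1, h2⟩ | ⟨h1, h2, b, h3⟩)
    · rw [h1, h2]; push_cast; ring
    · rw [h1, h2, h3, List.length_append, List.length_singleton]; push_cast; ring
  refine isAcyclic_of_rank
    (fun x : TreeVertex k d => ((2 * k + 1) * x.1.1.length - (x.1.2 : ℕ) : ℤ)) ?_
  intro v a b ha hb ra rb
  rw [tree_adj] at ha hb
  refine isParent_unique (ha.resolve_right fun h => ?_) (hb.resolve_right fun h => ?_)
  · have := key _ _ h; linarith
  · have := key _ _ h; linarith

open Classical in
lemma tree_degree_le_add (x : TreeVertex k d) :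
    (tree k d).degree x ≤ 1 + (Finset.univ.filter fun y => IsParent y x).card := by
  rw [← SimpleGraph.card_neighborFinset_eq_degree]
  have hsub : (tree k d).neighborFinset x ⊆
      (Finset.univ.filter fun y => IsParent x y) ∪ Finset.univ.filter fun y => IsParent y x := by
    intro y hy
    rw [SimpleGraph.mem_neighborFinset, tree_adj] at hy
    simpa using hy
  refine (Finset.card_le_card hsub).trans ((Finset.card_union_le _ _).trans ?_)
  gcongr
  rw [Finset.card_le_one]
  intro a ha b hb
  simp only [Finset.mem_filter, Finset.mem_univ, true_and] at ha hb
  exact isParent_unique ha hb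

open Classical in
lemma tree_degree_le (x : TreeVertex k d) : (tree k d).degree x ≤ 3 := by
  refine (tree_degree_le_add x).trans ?_
  have : (Finset.univ.filter fun y => IsParent y x).card ≤ (Finset.univ : Finset Bool).card := by
    -- The children of a branch vertex differ in the last letter of their words; a subdivision
    -- vertex has at most one child.
    refine Finset.card_le_card_of_injOn (fun y => y.1.1.getLast? == some true)
      (fun _ _ => Finset.mem_coe.mpr (Finset.mem_univ _)) ?_
    intro y hy z hz hyz
    simp only [Finset.coe_filter, Finset.mem_univ, true_and, Set.mem_ofPred_eq] at hy hz
    obtain ⟨⟨w, i⟩, hx⟩ := x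
    obtain ⟨⟨w₁, i₁⟩, h₁⟩ := y
    obtain ⟨⟨w₂, i₂⟩, h₂⟩ := z
    simp only [IsParent] at hy hz hyz
    rcases hy with ⟨rfl, e₁⟩ | ⟨e₁, e₁', b, rfl⟩ <;>
      rcases hz with ⟨e₂', e₂⟩ | ⟨e₂, e₂', c, rfl⟩
    · exact TreeVertex.ext e₂'.symm (by dsimp only; omega)
    · omega
    · omega
    · have hbc : b = c := by simpa using hyz
      exact TreeVertex.ext (by simp [hbc]) (by dsimp only; omega)
  rw [Finset.card_univ, Fintype.card_bool] at this
  omega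

open Classical in
lemma eq_zero_of_three_le_degree {x : TreeVertex k d} (hx : 3 ≤ (tree k d).degree x) :
    (x.1.2 : ℕ) = 0 := by
  by_contra h0
  have : (Finset.univ.filter fun y => IsParent y x).card ≤ 1 := by
    rw [Finset.card_le_one]
    intro a ha b hb
    rcases (Finset.mem_filter.mp ha).2 with ⟨h1, h2⟩ | h1
    · rcases (Finset.mem_filter.mp hb).2 with ⟨h3, h4⟩ | h3
      · exact TreeVertex.ext (h1.trans h3.symm) (by omega)
      · exact absurd h3.2.1 h0
    · exact absurd h1.2.1 h0
  have := tree_degree_le_add x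
  omega

theorem tree_maxDegree_le (k d : ℕ) : (tree k d).maxDegree ≤ 3 :=
  (tree k d).maxDegree_le_of_forall_degree_le 3 tree_degree_le

theorem tree_maxDegree_eq (k : ℕ) (hd : 2 ≤ d) : (tree k d).maxDegree = 3 := by
  classical
  refine le_antisymm (tree_maxDegree_le k d) ?_
  set x : TreeVertex k d := ⟨([true], 0), by simp; omega, by simp⟩ with hx
  set y : Bool → TreeVertex k d :=
    fun b => ⟨([true, b], ⟨2 * k, by omega⟩), by simpa using hd, by simp⟩ with hy
  have hyx : ∀ b, IsParent (y b) x := fun b => Or.inr ⟨rfl, rfl, b, rfl⟩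
  obtain ⟨p, hp⟩ : ∃ p, IsParent x p := by
    rcases Nat.eq_zero_or_pos k with rfl | hk
    · exact ⟨⟨([], 0), by simp, by simp⟩, Or.inr ⟨rfl, rfl, true, rfl⟩⟩
    · exact ⟨⟨([true], ⟨1, by omega⟩), by simp; omega, by simp⟩, Or.inl ⟨rfl, rfl⟩⟩
  have hpy : ∀ b, p ≠ y b := by
    rintro b rfl
    rcases hp with ⟨h, -⟩ | ⟨-, -, c, h⟩
    · simp [hx, hy] at h
    · simp [hx, hy] at h
  have hyy : y true ≠ y false := fun h => by
    have := congrArg (fun v => v.1.1) h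
    simp [hy] at this
  have hsub : ({p, y true, y false} : Finset (TreeVertex k d)) ⊆ (tree k d).neighborFinset x := by
    intro v hv
    rw [SimpleGraph.mem_neighborFinset, tree_adj]
    simp only [Finset.mem_insert, Finset.mem_singleton] at hv
    rcases hv with rfl | rfl | rfl
    · exact Or.inl hp
    · exact Or.inr (hyx _)
    · exact Or.inr (hyx _)
  have hcard := Finset.card_le_card hsub
  rw [Finset.card_insert_of_notMem (by simp [hpy]), Finset.card_pair hyy,
    SimpleGraph.card_neighborFinset_eq_degree] at hcard
  exact hcard.trans ((tree k d).degree_le_maxDegree x)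

/-- Distinct branch vertices are far apart. -/
lemma length_walk_of_branch {x y : TreeVertex k d} (hx : (x.1.2 : ℕ) = 0) (hy : (y.1.2 : ℕ) = 0)
    (hxy : x ≠ y) (p : (tree k d).Walk x y) : 2 * k + 1 ≤ p.length := by
  classical
  set w := x.1.1 with hw
  -- ψ is the distance from x cut off at 2k + 1, hence 1-Lipschitz: up the edge above x it is the
  -- index, down the two edges below it is 2k + 1 minus the index.
  set ψ : TreeVertex k d → ℕ := fun z =>
    if z.1.1 = w then z.1.2 else if ∃ b, z.1.1 = w ++ [b] then 2 * k + 1 - z.1.2 else 2 * k + 1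
    with hψ
  have hpar : ∀ a b, IsParent a b → ψ b ≤ ψ a + 1 ∧ ψ a ≤ ψ b + 1 := by
    rintro ⟨⟨w₁, i₁⟩, h₁⟩ ⟨⟨w₂, i₂⟩, h₂⟩ h
    have b₁ := i₁.2
    have b₂ := i₂.2
    simp only [IsParent] at h
    simp only [hψ]
    rcases h with ⟨rfl, e⟩ | ⟨e, e', c, rfl⟩
    · split_ifs <;> omega
    · by_cases h1 : w₂ = w
      · subst h1
        simp [e, e']
      · have h2 : ¬ ∃ b, w₂ ++ [c] = w ++ [b] := by
          rintro ⟨b, hb⟩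
          exact h1 (by simpa using congrArg List.dropLast hb)
        rw [if_neg h1, if_neg h2]
        split_ifs <;> omega
  have hlip : ∀ a b, (tree k d).Adj a b → ψ b ≤ ψ a + 1 := by
    intro a b hab
    rcases tree_adj.mp hab with h | h
    · exact (hpar _ _ h).1
    · exact (hpar _ _ h).2
  have hmain := le_add_length_of_lipschitz hlip p
  have hψx : ψ x = 0 := by simp only [hψ]; rw [if_pos hw.symm, hx]
  have hψy : ψ y = 2 * k + 1 := by
    have hne : y.1.1 ≠ w := fun h =>
      hxy (TreeVertex.ext (hw.symm.trans h.symm) (hx.trans hy.symm))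
    simp only [hψ]
    rw [if_neg hne, hy]
    split_ifs <;> rfl
  omega

/-- An embedding preserves cycles and does not lower degrees. Two vertices of degree 3 go to
distinct branch vertices, and a shortest walk between them to one of length below k < 2k + 1. -/
theorem isFree_tree {V : Type*} [Fintype V] {H : SimpleGraph V} [DecidableRel H.Adj]
    (hconn : H.Connected) (hk : Admissible H k) (d : ℕ) : IsFree H (tree k d) := by
  rintro ⟨e⟩
  rcases hk with h | ⟨v, hv⟩ | ⟨u, v, huv, hu, hv, hdist⟩
  · exact h ((tree_isAcyclic k d).embedding e)
  · have h1 := degree_le_degree_of_embedding e v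
    have h2 := tree_degree_le (e v)
    omega
  · obtain ⟨p, hp⟩ := hconn.exists_walk_length_eq_dist u v
    have h1 := degree_le_degree_of_embedding e u
    have h2 := degree_le_degree_of_embedding e v
    have h3 := length_walk_of_branch (eq_zero_of_three_le_degree (hu ▸ h1))
      (eq_zero_of_three_le_degree (hv ▸ h2)) (e.injective.ne huv) (p.map e.toHom)
    rw [SimpleGraph.Walk.length_map] at h3
    omega

end Tree

/-! ### Connected graphs without an admissible parameter. -/

section Classification

variable {V W : Type*}

/-- A bijective homomorphism from a connected graph to an acyclic one is an isomorphism. -/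
lemma nonempty_iso_of_bijective_hom {G : SimpleGraph W} {H : SimpleGraph V} (hG : G.Connected)
    (hH : H.IsAcyclic) (f : G →g H) (hf : Function.Bijective f) : Nonempty (H ≃g G) := by
  have hadj : ∀ {x y}, H.Adj (f x) (f y) ↔ G.Adj x y := by
    intro x y
    refine ⟨fun h => ?_, f.map_adj⟩
    obtain ⟨p, hp⟩ := (hG.preconnected x y).exists_isPath
    have h1 : (p.map f).IsPath := hp.map hf.1
    -- An edge between the images is itself a path, and uniqueness of paths in H forces the image of
    -- p to have length one.
    have h2 : (SimpleGraph.Walk.cons h SimpleGraph.Walk.nil).IsPath := by simp [h.ne]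
    have := hH.subsingleton_path (f x) (f y)
    have h3 := congrArg (fun q => q.1.length)
      (Subsingleton.elim (⟨_, h1⟩ : H.Path (f x) (f y)) ⟨_, h2⟩)
    simp only [SimpleGraph.Walk.length_map, SimpleGraph.Walk.length_cons,
      SimpleGraph.Walk.length_nil, zero_add] at h3
    exact SimpleGraph.Walk.adj_of_length_eq_one h3
  exact ⟨(⟨Equiv.ofBijective f hf, hadj⟩ : G ≃g H).symm⟩

lemma forall_mem_of_connected {G : SimpleGraph V} (hG : G.Connected) {S : Set V} {r : V}
    (hr : r ∈ S) (hS : ∀ v ∈ S, ∀ u, G.Adj v u → u ∈ S) (v : V) : v ∈ S := by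
  obtain ⟨p⟩ := hG.preconnected r v
  induction p with
  | nil => exact hr
  | cons h p ih => exact ih (hS _ hr _ h)

/-- If all vertices but the root have degree at most two, then a longest path from the root through
a given neighbour contains all neighbours of its vertices other than the root. -/
lemma exists_longest_path [Fintype V] {G : SimpleGraph V} [DecidableRel G.Adj] {r s : V}
    (hrs : G.Adj r s) (hdeg : ∀ v, v ≠ r → G.degree v ≤ 2) :
    ∃ (w : V) (p : G.Walk r w), p.IsPath ∧ 1 ≤ p.length ∧ p.getVert 1 = s ∧
      ∀ v ∈ p.support, v ≠ r → ∀ u, G.Adj v u → u ∈ p.support := by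
  classical
  set P : ℕ → Prop := fun n => ∃ (w : V) (p : G.Walk r w), p.IsPath ∧ 1 ≤ p.length ∧
    p.getVert 1 = s ∧ p.length = n with hP
  have h1 : P 1 := ⟨s, SimpleGraph.Walk.cons hrs SimpleGraph.Walk.nil, by simp [hrs.ne], by simp,
    by simp, by simp⟩
  have hcard : 1 ≤ Fintype.card V := Fintype.card_pos_iff.mpr ⟨r⟩
  obtain ⟨w, p, hp, hlen, hs, hn⟩ := Nat.findGreatest_spec hcard h1
  refine ⟨w, p, hp, hlen, hs, fun v hv hvr u hu => ?_⟩
  obtain ⟨i, rfl, hi⟩ := SimpleGraph.Walk.mem_support_iff_exists_getVert.mp hv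
  have hi0 : 1 ≤ i := by
    by_contra h
    rw [Nat.lt_one_iff.mp (not_le.mp h)] at hvr
    simp at hvr
  by_contra hmem
  -- A new neighbour gives an interior vertex degree at least 3, and at the end it would prolong the
  -- path.
  rcases hi.lt_or_eq with hlt | rfl
  · have a1 := p.adj_getVert_succ hlt
    have a2 := p.adj_getVert_succ (show i - 1 < p.length by omega)
    rw [Nat.sub_add_cancel hi0] at a2
    have hne : p.getVert (i - 1) ≠ p.getVert (i + 1) := fun h => by
      have := hp.getVert_injOn (show i - 1 ≤ p.length by omega)
        (show i + 1 ≤ p.length by omega) h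
      omega
    have hsub : ({u, p.getVert (i - 1), p.getVert (i + 1)} : Finset V) ⊆
        G.neighborFinset (p.getVert i) := by
      intro x hx
      rw [SimpleGraph.mem_neighborFinset]
      simp only [Finset.mem_insert, Finset.mem_singleton] at hx
      rcases hx with rfl | rfl | rfl
      exacts [hu, a2.symm, a1]
    have hc := Finset.card_le_card hsub
    have hu' : ∀ j, u ≠ p.getVert j := fun j h => hmem (h ▸ p.getVert_mem_support j)
    rw [Finset.card_insert_of_notMem (by simp [hu']), Finset.card_pair hne,
      SimpleGraph.card_neighborFinset_eq_degree] at hc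
    have := hdeg _ hvr
    omega
  · rw [SimpleGraph.Walk.getVert_length] at hu
    have hq := hp.concat hmem hu
    have hql : (p.concat hu).length = p.length + 1 := SimpleGraph.Walk.length_concat p hu
    refine Nat.findGreatest_is_greatest (P := P) (n := Fintype.card V) (k := p.length + 1)
      (by omega) (by have := hq.length_lt; omega) ⟨u, p.concat hu, hq, by omega, ?_, hql⟩
    rw [SimpleGraph.Walk.concat_eq_append, SimpleGraph.Walk.getVert_append]
    split_ifs with h
    · exact hs
    · rw [← hs, show p.length = 1 by omega]
      simp only [Nat.sub_self, SimpleGraph.Walk.getVert_zero]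
      rw [show 1 = p.length by omega, SimpleGraph.Walk.getVert_length]

/-- A longest path from a leaf is closed under adjacency, so by connectedness it is everything. -/
lemma isPathGraph_of_degree_le_two [Fintype V] {G : SimpleGraph V} [DecidableRel G.Adj]
    (hconn : G.Connected) (hac : G.IsAcyclic) (hdeg : ∀ v, G.degree v ≤ 2) : IsPathGraph G := by
  classical
  rcases subsingleton_or_nontrivial V with hV | hV
  · obtain ⟨v⟩ := hconn.nonempty
    refine ⟨1, nonempty_iso_of_bijective_hom (SimpleGraph.pathGraph_connected 0) hac
      ⟨fun _ => v, fun {a b} h => absurd (Subsingleton.elim a b) h.ne⟩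
      ⟨fun a b _ => Subsingleton.elim a b, fun u => ⟨0, Subsingleton.elim _ _⟩⟩⟩
  · obtain ⟨r, hr⟩ :=
      (⟨hconn, hac⟩ : G.IsTree).exists_vert_degree_one_of_nontrivial
    rw [← SimpleGraph.card_neighborFinset_eq_degree, Finset.card_eq_one] at hr
    obtain ⟨s, hs⟩ := hr
    have hnb : ∀ u, G.Adj r u ↔ u = s := fun u => by
      rw [← SimpleGraph.mem_neighborFinset, hs, Finset.mem_singleton]
    obtain ⟨w, p, hp, hlen, hp1, hcl⟩ := exists_longest_path ((hnb s).mpr rfl) fun v _ => hdeg v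
    have hall : ∀ v, v ∈ p.support := forall_mem_of_connected hconn (S := {v | v ∈ p.support})
      p.start_mem_support fun v hv u hu => by
        by_cases hvr : v = r
        · rw [hvr, hnb] at hu
          rw [hu, ← hp1]
          exact p.getVert_mem_support 1
        · exact hcl v hv hvr u hu
    refine ⟨p.length + 1, nonempty_iso_of_bijective_hom (SimpleGraph.pathGraph_connected _) hac
      ⟨fun i => p.getVert i, fun {a b} h => ?_⟩ ⟨fun a b h => ?_, fun v => ?_⟩⟩
    · rcases SimpleGraph.pathGraph_adj.mp h with h | h
      · rw [← h]
        exact p.adj_getVert_succ (by omega)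
      · rw [← h]
        exact (p.adj_getVert_succ (by omega)).symm
    · exact Fin.ext (hp.getVert_injOn (Nat.lt_succ_iff.mp a.2) (Nat.lt_succ_iff.mp b.2) h)
    · obtain ⟨n, hn, hnl⟩ := SimpleGraph.Walk.mem_support_iff_exists_getVert.mp (hall v)
      exact ⟨⟨n, Nat.lt_succ_iff.mpr hnl⟩, hn⟩

lemma subdividedClaw_connected (a b c : ℕ) : (subdividedClaw a b c).Connected := by
  have key : ∀ t, ∀ n (hn : n < ![a, b, c] t),
      (subdividedClaw a b c).Reachable none (some ⟨t, ⟨n, hn⟩⟩) := by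
    intro t n
    induction n with
    | zero =>
      intro hn
      refine SimpleGraph.Adj.reachable ?_
      rw [subdividedClaw, SimpleGraph.fromRel_adj]
      exact ⟨by simp, Or.inl (Or.inl ⟨rfl, t, ⟨0, hn⟩, rfl, rfl⟩)⟩
    | succ n ih =>
      intro hn
      refine (ih (by omega)).trans (SimpleGraph.Adj.reachable ?_)
      rw [subdividedClaw, SimpleGraph.fromRel_adj]
      refine ⟨by simp, Or.inl (Or.inr ⟨t, ⟨n, by omega⟩, ⟨n + 1, hn⟩, rfl, rfl, rfl⟩)⟩
  have hr : ∀ x, (subdividedClaw a b c).Reachable none x := by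
    rintro (_ | ⟨t, n, hn⟩)
    · exact SimpleGraph.Reachable.refl _
    · exact key t n hn
  exact { preconnected := fun x y => (hr x).symm.trans (hr y), nonempty := ⟨none⟩ }

/-- An acyclic connected graph that is the union of three paths from `r`, which leave `r` through
its three neighbours, is a subdivided claw. -/
lemma nonempty_iso_subdividedClaw {G : SimpleGraph V} (hconn : G.Connected) (hac : G.IsAcyclic)
    {r : V} {s w : Fin 3 → V} (hs : ∀ u, G.Adj r u → ∃ t, s t = u) (hinj : Function.Injective s)
    (p : ∀ t, G.Walk r (w t)) (hp : ∀ t, (p t).IsPath) (hlen : ∀ t, 1 ≤ (p t).length)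
    (hp1 : ∀ t, (p t).getVert 1 = s t)
    (hcl : ∀ t, ∀ v ∈ (p t).support, v ≠ r → ∀ u, G.Adj v u → u ∈ (p t).support)
    {a b c : ℕ} (habc : ∀ t : Fin 3, ![a, b, c] t = (p t).length) :
    Nonempty (G ≃g subdividedClaw a b c) := by
  set f : Option (Σ t : Fin 3, Fin (![a, b, c] t)) → V := fun x =>
    x.elim r fun y => (p y.1).getVert (y.2 + 1) with hf
  have hlt : ∀ t (i : Fin (![a, b, c] t)), (i : ℕ) + 1 ≤ (p t).length := fun t i => by
    have := i.2
    have := habc t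
    omega
  have hmem : ∀ t n, n ≤ (p t).length → ∃ x, f x = (p t).getVert n := by
    intro t n hn
    rcases Nat.eq_zero_or_pos n with rfl | h
    · exact ⟨none, by simp [hf]⟩
    · refine ⟨some ⟨t, ⟨n - 1, by rw [habc]; omega⟩⟩, ?_⟩
      simp only [hf, Option.elim_some]
      rw [Nat.sub_add_cancel h]
  have hrel : ∀ x y : Option (Σ t : Fin 3, Fin (![a, b, c] t)),
      ((x = none ∧ ∃ t p, y = some ⟨t, p⟩ ∧ (p : ℕ) = 0) ∨
        (∃ t p q, x = some ⟨t, p⟩ ∧ y = some ⟨t, q⟩ ∧ (q : ℕ) = p + 1)) → G.Adj (f x) (f y) := by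
    rintro x y (⟨rfl, t, i, rfl, hi⟩ | ⟨t, i, j, rfl, rfl, hij⟩)
    · have := (p t).adj_getVert_succ (hlen t)
      simpa [hf, hi] using this
    · have := (p t).adj_getVert_succ (show (i : ℕ) + 1 < (p t).length by have := hlt t j; omega)
      simpa [hf, hij] using this
  refine nonempty_iso_of_bijective_hom (subdividedClaw_connected a b c) hac
    ⟨f, fun {x y} h => ?_⟩ ⟨?_, fun v => ?_⟩
  · rw [subdividedClaw, SimpleGraph.fromRel_adj] at h
    rcases h.2 with h | h
    · exact hrel _ _ h
    · exact (hrel _ _ h).symm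
  · have hr : ∀ t (i : Fin (![a, b, c] t)), r ≠ (p t).getVert (i + 1) := fun t i h => by
      have := (hp t).getVert_injOn (Nat.zero_le _) (hlt t i) ((p t).getVert_zero.trans h)
      omega
    rintro (_ | ⟨t, i⟩) (_ | ⟨t', j⟩) h
    · rfl
    · exact absurd h (hr t' j)
    · exact absurd h.symm (hr t i)
    · have h' : (p t).getVert (i + 1) = (p t').getVert (j + 1) := h
      -- If two legs met, their initial segments would be two paths from r to one vertex. They agree
      -- in a tree, hence start with the same neighbour and lie on the same leg.
      have q1 := (hp t).take (i + 1)
      have q2 := (hp t').take (j + 1)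
      have := hac.subsingleton_path r ((p t).getVert (i + 1))
      have he := Subsingleton.elim (⟨_, q1⟩ : G.Path r ((p t).getVert (i + 1)))
        ⟨((p t').take (j + 1)).copy rfl h'.symm, by simpa using q2⟩
      have he1 := congrArg (fun q => q.1.getVert 1) he
      simp only [SimpleGraph.Walk.getVert_copy, SimpleGraph.Walk.take_getVert] at he1
      rw [min_eq_right (by omega), min_eq_right (by omega), hp1, hp1] at he1
      obtain rfl := hinj he1
      have := (hp t).getVert_injOn (hlt t i) (hlt t j) h'
      have hij : i = j := Fin.ext (by omega)
      rw [hij]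
  · refine forall_mem_of_connected hconn (S := Set.range f) (r := r) ⟨none, rfl⟩ ?_ v
    rintro _ ⟨(_ | ⟨t, i⟩), rfl⟩ u hu
    · obtain ⟨t, rfl⟩ := hs u hu
      rw [← hp1]
      exact hmem t 1 (hlen t)
    · by_cases hvr : (p t).getVert (i + 1) = r
      · change G.Adj ((p t).getVert (i + 1)) u at hu
        rw [hvr] at hu
        obtain ⟨t, rfl⟩ := hs u hu
        rw [← hp1]
        exact hmem t 1 (hlen t)
      · have := hcl t _ ((p t).getVert_mem_support (i + 1)) hvr u hu
        obtain ⟨n, rfl, hn⟩ := SimpleGraph.Walk.mem_support_iff_exists_getVert.mp this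
        exact hmem t n hn

lemma isSubdividedClaw_of_degree [Fintype V] {G : SimpleGraph V} [DecidableRel G.Adj]
    (hconn : G.Connected) (hac : G.IsAcyclic) {r : V} (hr : G.degree r = 3)
    (hdeg : ∀ v, v ≠ r → G.degree v ≤ 2) : IsSubdividedClaw G := by
  classical
  rw [← SimpleGraph.card_neighborFinset_eq_degree] at hr
  set e := (Finset.equivFinOfCardEq hr).symm with he
  have hadj : ∀ t, G.Adj r (e t) := fun t => (SimpleGraph.mem_neighborFinset _ _ _).mp (e t).2
  choose w p hp hlen hp1 hcl using fun t => exists_longest_path (hadj t) hdeg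
  -- The legs are ordered by length to obtain a ≤ b ≤ c.
  set σ := Tuple.sort fun t => (p t).length with hσ
  have hmono : Monotone ((fun t => (p t).length) ∘ σ) := Tuple.monotone_sort _
  refine ⟨(p (σ 0)).length, (p (σ 1)).length, (p (σ 2)).length, hlen _,
    hmono (by decide : (0 : Fin 3) ≤ 1), hmono (by decide : (1 : Fin 3) ≤ 2), ?_⟩
  refine nonempty_iso_subdividedClaw hconn hac (r := r) (s := fun t => (e (σ t) : V)) ?_ ?_
    (fun t => p (σ t)) (fun t => hp _) (fun t => hlen _) (fun t => hp1 _) (fun t => hcl _) ?_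
  · intro u hu
    refine ⟨σ.symm (e.symm ⟨u, (SimpleGraph.mem_neighborFinset _ _ _).mpr hu⟩), ?_⟩
    simp
  · exact Subtype.val_injective.comp (e.injective.comp σ.injective)
  · intro t
    fin_cases t <;> rfl

/-- Inadmissibility of 0 excludes cycles and degrees above 3; inadmissibility of dist(r, v) + 1
excludes a second vertex v of degree 3. -/
theorem exists_admissible [Fintype V] (H : SimpleGraph V) [DecidableRel H.Adj]
    (hconn : H.Connected) (hpath : ¬ IsPathGraph H) (hclaw : ¬ IsSubdividedClaw H) :
    ∃ k : ℕ, Admissible H k := by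
  by_contra! hno
  have hac : H.IsAcyclic := by
    by_contra h
    exact hno 0 (Or.inl h)
  have h3 : ∀ v, H.degree v ≤ 3 := fun v => by
    by_contra h
    exact hno 0 (Or.inr (Or.inl ⟨v, by omega⟩))
  by_cases h2 : ∀ v, H.degree v ≤ 2
  · exact hpath (isPathGraph_of_degree_le_two hconn hac h2)
  · push Not at h2
    obtain ⟨r, hr⟩ := h2
    have hr3 : H.degree r = 3 := le_antisymm (h3 r) hr
    refine hclaw (isSubdividedClaw_of_degree hconn hac hr3 fun v hv => ?_)
    by_contra h
    exact hno (H.dist r v + 1) (Or.inr (Or.inr ⟨r, v, hv.symm, hr3,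
      le_antisymm (h3 v) (not_le.mp h), Nat.lt_succ_self _⟩))

end Classification

end HFreeZeros

theorem lemma6p1 {V : Type*} [Fintype V] (H : SimpleGraph V) [DecidableRel H.Adj]
    (hconn : H.Connected) (hpath : ¬ HFreeZeros.IsPathGraph H)
    (hclaw : ¬ HFreeZeros.IsSubdividedClaw H) :
    (∃ k : ℕ, HFreeZeros.Admissible H k) ∧
    ∀ k : ℕ, HFreeZeros.Admissible H k →
      (∀ d : ℕ, HFreeZeros.IsFree H (HFreeZeros.tree k d)) ∧
      (∀ d : ℕ, (HFreeZeros.tree k d).maxDegree ≤ 3) ∧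
      (∀ d : ℕ, 2 ≤ d → (HFreeZeros.tree k d).maxDegree = 3) ∧
      ∃ x : ℝ, 0 < x ∧
        AccPt (x : ℂ)
          (Filter.principal
            {z : ℂ | ∃ d : ℕ, HFreeZeros.indepZ (HFreeZeros.tree k d) (fun _ => z) = 0}) := by
  refine ⟨HFreeZeros.exists_admissible H hconn hpath hclaw, fun k hk =>
    ⟨HFreeZeros.isFree_tree hconn hk, HFreeZeros.tree_maxDegree_le k,
      fun d hd => HFreeZeros.tree_maxDegree_eq k hd, ?_⟩⟩
  simp only [HFreeZeros.indepZ_tree]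
  exact HFreeZeros.exists_accPt_rootPair_zeros k
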